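/- Let $\mathbb C[t,t^{-1}]$ be the algebra of Laurent polynomials and let $L_W=\operatorname{Der}(\mathbb C[t,t^{-1}])$ be the Witt algebra, with basis $x_m=-t^{m+1}\frac{d}{dt}$ ($m\in\mathbb Z$). Let $L_V=L_W\oplus\mathbb C c$ be the Virasoro algebra: $c$ is central and $$[x_m,x_n]=(m-n)\,x_{m+n}+\delta_{m+n,0}\,\frac{m^3-m}{12}\,c .$$ For a field $F$ and $a\in M_n(F)$ put $\rho_n(a)=\frac1n\operatorname{rk}(a)$. A Lie algebra $L$ over $F$ is called (linearly) sofic if there are a non-principal ultrafilter $\omega$ on $\mathbb N$, a sequence of natural numbers $n_k\to\infty$, and an injective homomorphism of Lie algebras over $F$ $$L\hookrightarrow \Big(\prod_{k}M_{n_k}(F)\Big)\Big/\Big\{(a_k)_k:\ \lim_{k\to\omega}\rho_{n_k}(a_k)=0\Big\},$$ where the quotient algebra carries the commutator bracket. By a nontrivial one-dimensional central extension of a Lie algebra $Q$ we mean a surjective homomorphism of Lie algebras $p:L\to Q$ whose kernel is one-dimensional and central in $L$, and for which there is no Lie algebra homomorphism $s:Q\to L$ with $p\circ s=\mathrm{id}_Q$.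 Then the following hold. 1. The projection $\pi:L_V\to L_W$ with $\pi(c)=0$ is a nontrivial one-dimensional central extension of $L_W$. 2. It is the unique one: for every nontrivial one-dimensional central extension $p:L\to L_W$ there is an isomorphism of Lie algebras $e:L\to L_V$ with $\pi\circ e=p$. 3. The Virasoro algebra $L_V$ is sofic over $\mathbb C$. -/

import Mathlib

open Filter Topology
open scoped LaurentPolynomial

noncomputable section

/-! ### Metric ultraproducts of matrix algebras and soficity -/

namespace Sofic

variable (F : Type*) [Field F]

/-- The normalized rank `ρ_n(a) = rk(a) / n` of an `n × n` matrix. -/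
def normalizedRank {F : Type*} [Field F] {n : ℕ} (a : Matrix (Fin n) (Fin n) F) : ℝ :=
  (a.rank : ℝ) / (n : ℝ)

theorem normalizedRank_nonneg {F : Type*} [Field F] {n : ℕ} (a : Matrix (Fin n) (Fin n) F) :
    0 ≤ normalizedRank a := by
  unfold normalizedRank; positivity

theorem rank_add_le {F : Type*} [Field F] {n : ℕ} (a b : Matrix (Fin n) (Fin n) F) :
    (a + b).rank ≤ a.rank + b.rank := by
  unfold Matrix.rank
  rw [Matrix.mulVecLin_add]
  refine (Submodule.finrank_mono (LinearMap.range_add_le _ _)).trans ?_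
  exact Submodule.finrank_add_le_finrank_add_finrank _ _

/-- The ideal `ρ_ω⁻¹(0)` of `∏ₖ M_{n_k}(F)`: all sequences of matrices whose normalized ranks
tend to `0` along `ω`. -/
def rankKernel (ω : Ultrafilter ℕ) (n : ℕ → ℕ) :
    Ideal ((k : ℕ) → Matrix (Fin (n k)) (Fin (n k)) F) where
  carrier := {a | Tendsto (fun k => normalizedRank (a k)) ω (𝓝 0)}
  zero_mem' := by simp [normalizedRank]
  add_mem' := by
    intro a b ha hb
    have h := Tendsto.add ha hb
    rw [add_zero] at h
    refine squeeze_zero (fun k => normalizedRank_nonneg _) (fun k => ?_) h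
    simp only [normalizedRank, Pi.add_apply, ← add_div]
    gcongr
    exact_mod_cast rank_add_le (a k) (b k)
  smul_mem' := by
    intro c a ha
    refine squeeze_zero (fun k => normalizedRank_nonneg _) (fun k => ?_) ha
    simp only [normalizedRank, smul_eq_mul, Pi.mul_apply]
    gcongr
    exact Matrix.rank_mul_le_right (c k) (a k)

instance rankKernel_isTwoSided (ω : Ultrafilter ℕ) (n : ℕ → ℕ) :
    (rankKernel F ω n).IsTwoSided where
  mul_mem_of_left := by
    intro a b ha
    refine squeeze_zero (fun k => normalizedRank_nonneg _) (fun k => ?_) ha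
    simp only [normalizedRank, Pi.mul_apply]
    gcongr
    exact Matrix.rank_mul_le_left (a k) (b k)

/-- The metric ultraproduct `∏_{k → ω} M_{n_k}(F) / ker ρ_ω`. -/
abbrev Ultraproduct (ω : Ultrafilter ℕ) (n : ℕ → ℕ) : Type _ :=
  ((k : ℕ) → Matrix (Fin (n k)) (Fin (n k)) F) ⧸ rankKernel F ω n

/-- The universal sofic Lie algebra `∏_{k → ω} gl_{n_k}(F) / ker ρ_ω`: the metric ultraproduct
with the commutator bracket. -/
instance ultraproductLieRing (ω : Ultrafilter ℕ) (n : ℕ → ℕ) : LieRing (Ultraproduct F ω n) :=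
  LieRing.ofAssociativeRing

instance ultraproductLieAlgebra (ω : Ultrafilter ℕ) (n : ℕ → ℕ) :
    LieAlgebra F (Ultraproduct F ω n) :=
  LieAlgebra.ofAssociativeAlgebra

/-- A Lie algebra over `F` is (linearly) sofic if it embeds into the metric ultraproduct
`∏_{k → ω} gl_{n_k}(F) / ker ρ_ω` for some non-principal ultrafilter `ω` on `ℕ` and some sequence
of natural numbers `n_k → ∞`. -/
def IsSofic (L : Type*) [LieRing L] [LieAlgebra F L] : Prop :=
  ∃ (ω : Ultrafilter ℕ) (n : ℕ → ℕ), (∀ k : ℕ, ω ≠ pure k) ∧ Tendsto n atTop atTop ∧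
    ∃ Θ : L →ₗ⁅F⁆ Ultraproduct F ω n, Function.Injective Θ

end Sofic

/-! ### The Witt and Virasoro algebras -/

/-- The Witt algebra: the Lie algebra of derivations of `ℂ[t, t⁻¹]`. -/
abbrev Witt : Type := Derivation ℂ ℂ[T;T⁻¹] ℂ[T;T⁻¹]

namespace Virasoro

open LaurentPolynomial

/-- The bilinear form on `ℂ[t, t⁻¹]` with
`(∑ᵢ aᵢ tⁱ, ∑ⱼ bⱼ tʲ) ↦ ∑ₘ (m³ - m) / 12 * a_{m+1} * b_{-m+1}` (here `i = m + 1`). -/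
def form : ℂ[T;T⁻¹] →ₗ[ℂ] ℂ[T;T⁻¹] →ₗ[ℂ] ℂ :=
  LinearMap.mk₂ ℂ
    (fun f g => f.coeff.sum fun i a =>
      ((((i : ℂ) - 1) ^ 3 - ((i : ℂ) - 1)) / 12) * a * g.coeff (2 - i))
    (fun f f' g => by
      simp only [AddMonoidAlgebra.coeff_add]
      exact Finsupp.sum_add_index' (by simp) (by intros; ring))
    (fun c f g => by
      simp only [AddMonoidAlgebra.coeff_smul, smul_eq_mul]
      rw [Finsupp.sum_smul_index' (by simp), Finsupp.mul_sum]
      exact Finsupp.sum_congr fun _ _ => by simp only [smul_eq_mul]; ring)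
    (fun f g g' => by
      rw [← Finsupp.sum_add]
      exact Finsupp.sum_congr fun _ _ => by
        simp only [AddMonoidAlgebra.coeff_add, Finsupp.add_apply]; ring)
    (fun c f g => by
      rw [smul_eq_mul, Finsupp.mul_sum]
      exact Finsupp.sum_congr fun _ _ => by
        simp only [AddMonoidAlgebra.coeff_smul, Finsupp.smul_apply, smul_eq_mul]; ring)

theorem form_T (i j : ℤ) :
    form (T i) (T j) = if i + j = 2 then (((i : ℂ) - 1) ^ 3 - ((i : ℂ) - 1)) / 12 else 0 := by
  have h : form (T i) (T j) = ((((i : ℂ) - 1) ^ 3 - ((i : ℂ) - 1)) / 12) * 1 *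
      (T j : ℂ[T;T⁻¹]).coeff (2 - i) :=
    Finsupp.sum_single_index (a := i) (b := (1 : ℂ))
      (h := fun i a => ((((i : ℂ) - 1) ^ 3 - ((i : ℂ) - 1)) / 12) * a *
        (T j : ℂ[T;T⁻¹]).coeff (2 - i)) (by simp)
  rw [h, T_apply]
  by_cases hij : i + j = 2
  · rw [if_pos hij, if_pos (by lia)]; ring
  · rw [if_neg hij, if_neg (by lia)]; ring

/-- The derivative `f ↦ f'` of Laurent polynomials. -/
def deriv : ℂ[T;T⁻¹] →ₗ[ℂ] ℂ[T;T⁻¹] where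
  toFun f := f.coeff.sum fun i a => ((i : ℂ) * a) • T (i - 1)
  map_add' f g := by
    simp only [AddMonoidAlgebra.coeff_add]
    exact Finsupp.sum_add_index' (by simp) (by intros; rw [mul_add, add_smul])
  map_smul' c f := by
    simp only [AddMonoidAlgebra.coeff_smul, RingHom.id_apply]
    rw [Finsupp.sum_smul_index' (by simp), Finsupp.sum, Finsupp.sum, Finset.smul_sum]
    exact Finset.sum_congr rfl fun _ _ => by
      rw [smul_smul]; congr 1; simp only [smul_eq_mul]; ring

theorem deriv_T (i : ℤ) : deriv (T i) = (i : ℂ) • T (i - 1) := by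
  have h : deriv (T i) = ((i : ℂ) * 1) • (T (i - 1) : ℂ[T;T⁻¹]) :=
    Finsupp.sum_single_index (a := i) (b := (1 : ℂ))
      (h := fun i a => ((i : ℂ) * a) • (T (i - 1) : ℂ[T;T⁻¹])) (by simp)
  rw [h, mul_one]

theorem linearMap_ext {M : Type*} [AddCommMonoid M] [Module ℂ M] {u v : ℂ[T;T⁻¹] →ₗ[ℂ] M}
    (h : ∀ i : ℤ, u (T i) = v (T i)) : u = v := by
  refine LinearMap.ext fun f => ?_
  induction f using LaurentPolynomial.induction_on' with
  | add p q hp hq => rw [map_add, map_add, hp, hq]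
  | C_mul_T n a => rw [← smul_eq_C_mul, map_smul, map_smul, h]

/-- The derivation `d/dt` of `ℂ[t, t⁻¹]`. -/
def ddt : Witt :=
  Derivation.mk' deriv (by
    have h : LinearMap.compr₂ (LinearMap.mul ℂ ℂ[T;T⁻¹]) deriv =
        (LinearMap.mul ℂ ℂ[T;T⁻¹]).compl₂ deriv +
          ((LinearMap.mul ℂ ℂ[T;T⁻¹]).compl₂ deriv).flip := by
      refine linearMap_ext fun i => linearMap_ext fun j => ?_
      simp only [LinearMap.compr₂_apply, LinearMap.mul_apply', LinearMap.add_apply,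
        LinearMap.compl₂_apply, LinearMap.flip_apply, ← T_add, deriv_T, mul_smul_comm]
      rw [show i + (j - 1) = i + j - 1 by ring, show j + (i - 1) = i + j - 1 by ring, ← add_smul]
      congr 1
      push_cast
      ring
    intro f g
    exact LinearMap.congr_fun (LinearMap.congr_fun h f) g)

theorem ddt_T (i : ℤ) : ddt (T i) = (i : ℂ) • T (i - 1) := deriv_T i

theorem derivation_apply (D : Witt) (f : ℂ[T;T⁻¹]) : D f = D (T 1) * ddt f := by
  have hT (n : ℤ) : D (T n) = D (T 1) * ddt (T n) := by
    have step (i : ℤ) : D (T (i + 1)) - D (T 1) * ddt (T (i + 1)) =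
        T 1 * (D (T i) - D (T 1) * ddt (T i)) := by
      rw [T_add, D.leibniz, ddt.leibniz, ddt_T 1]
      simp only [smul_eq_mul, Int.cast_one, one_smul, sub_self, T_zero]
      ring
    induction n using Int.induction_on with
    | zero => simp
    | succ i hi => rw [← sub_eq_zero, step, hi, sub_self, mul_zero]
    | pred i hi =>
      have h := step (-(i : ℤ) - 1)
      rw [sub_add_cancel, hi, sub_self] at h
      rw [← sub_eq_zero]
      exact ((isUnit_T 1).mul_right_eq_zero).mp h.symm
  exact LinearMap.congr_fun (linearMap_ext (u := (D : ℂ[T;T⁻¹] →ₗ[ℂ] ℂ[T;T⁻¹]))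
    (v := (LinearMap.mul ℂ ℂ[T;T⁻¹] (D (T 1))).comp (ddt : ℂ[T;T⁻¹] →ₗ[ℂ] ℂ[T;T⁻¹])) hT) f

theorem lie_apply_T_one (D E : Witt) :
    ⁅D, E⁆ (T 1) = D (T 1) * ddt (E (T 1)) - E (T 1) * ddt (D (T 1)) := by
  rw [Derivation.commutator_apply, derivation_apply D, derivation_apply E (D (T 1))]

theorem form_skew (f g : ℂ[T;T⁻¹]) : form f g = - form g f := by
  have h : form = - form.flip := by
    refine linearMap_ext fun i => linearMap_ext fun j => ?_
    rw [LinearMap.neg_apply, LinearMap.neg_apply, LinearMap.flip_apply, form_T, form_T]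
    by_cases hij : i + j = 2
    · rw [if_pos hij, if_pos (by lia), show j = 2 - i by lia]
      push_cast
      ring
    · rw [if_neg hij, if_neg (by lia), neg_zero]
  exact LinearMap.congr_fun (LinearMap.congr_fun h f) g

theorem form_cocycle (f g h : ℂ[T;T⁻¹]) :
    form f (g * ddt h - h * ddt g) =
      form (f * ddt g - g * ddt f) h + form g (f * ddt h - h * ddt f) := by
  induction f using LaurentPolynomial.induction_on' with
  | add p q hp hq =>
    simp only [map_add, map_sub, add_mul, mul_add, LinearMap.add_apply, LinearMap.sub_apply]
      at hp hq ⊢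
    linear_combination hp + hq
  | C_mul_T i a =>
    induction g using LaurentPolynomial.induction_on' with
    | add p q hp hq =>
      simp only [map_add, map_sub, add_mul, mul_add, LinearMap.add_apply, LinearMap.sub_apply]
        at hp hq ⊢
      linear_combination hp + hq
    | C_mul_T j b =>
      induction h using LaurentPolynomial.induction_on' with
      | add p q hp hq =>
        simp only [map_add, map_sub, add_mul, mul_add, LinearMap.sub_apply]
          at hp hq ⊢
        linear_combination hp + hq
      | C_mul_T k c =>
        have key (i j : ℤ) : T i * ddt (T j) - T j * ddt (T i) =
            ((j : ℂ) - i) • (T (i + j - 1) : ℂ[T;T⁻¹]) := by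
          rw [ddt_T, ddt_T, mul_smul_comm, mul_smul_comm, ← T_add, ← T_add,
            show i + (j - 1) = i + j - 1 by ring, show j + (i - 1) = i + j - 1 by ring, sub_smul]
        have key' (i j : ℤ) (a b : ℂ) : (a • T i) * ddt (b • T j) - (b • T j) * ddt (a • T i) =
            (a * b * ((j : ℂ) - i)) • (T (i + j - 1) : ℂ[T;T⁻¹]) := by
          rw [mul_smul, ← key, Derivation.map_smul, Derivation.map_smul]
          simp only [smul_mul_assoc, mul_smul_comm, smul_smul, smul_sub]
          rw [mul_comm b a]
        rw [← smul_eq_C_mul, ← smul_eq_C_mul, ← smul_eq_C_mul, key', key', key']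
        simp only [map_smul, LinearMap.smul_apply, form_T, smul_eq_mul]
        by_cases hs : i + j + k = 3
        · rw [if_pos (by lia), if_pos (by lia), if_pos (by lia), show k = 3 - i - j by lia]
          push_cast
          ring
        · rw [if_neg (by lia), if_neg (by lia), if_neg (by lia)]
          ring

/-- The 2-cochain `(D, E) ↦ ∑ₘ (m³ - m) / 12 * a_{m+1} * b_{-m+1}` of the Witt algebra, where
`D = (∑ᵢ aᵢ tⁱ) d/dt` and `E = (∑ⱼ bⱼ tʲ) d/dt`. In terms of `x_m = -t^{m+1} d/dt` it is
`(x_m, x_n) ↦ (m³ - m) / 12` if `m + n = 0`, and `0` otherwise. -/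
def cochain : LieModule.Cohomology.twoCochain ℂ Witt (TrivialLieModule ℂ Witt ℂ) where
  val :=
    let ev : Witt →ₗ[ℂ] ℂ[T;T⁻¹] :=
      { toFun := fun D => D (T 1), map_add' := fun _ _ => rfl, map_smul' := fun _ _ => rfl }
    (form.compl₁₂ ev ev).compr₂ (TrivialLieModule.equiv ℂ Witt ℂ).symm.toLinearMap
  property := by
    intro D
    have h : form (D (T 1)) (D (T 1)) = 0 := by
      have := form_skew (D (T 1)) (D (T 1))
      linear_combination this / 2
    simpa using h

theorem cochain_apply (D E : Witt) :
    cochain D E = (TrivialLieModule.equiv ℂ Witt ℂ).symm (form (D (T 1)) (E (T 1))) := rfl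

/-- The Virasoro 2-cocycle of the Witt algebra with values in the trivial module `ℂ`. -/
def cocycle : LieModule.Cohomology.twoCocycle ℂ Witt (TrivialLieModule ℂ Witt ℂ) :=
  ⟨cochain, by
    rw [LieModule.Cohomology.mem_twoCocycle_iff_of_trivial]
    intro D E G
    simp only [cochain_apply, lie_apply_T_one, form_cocycle (D (T 1)), map_add]⟩

end Virasoro

/-- The Virasoro algebra: the central extension of the Witt algebra by `ℂ` given by the Virasoro
2-cocycle. It has the basis `x_m = -t^{m+1} d/dt` (`m ∈ ℤ`) and a central element `c`, and
`[x_m, x_n] = (m - n) x_{m+n} + δ_{m+n,0} (m³ - m) / 12 * c`. -/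
abbrev VirasoroAlgebra : Type := LieAlgebra.ofTwoCocycle Virasoro.cocycle

namespace Virasoro

/-- The projection of the Virasoro algebra onto the Witt algebra. -/
def proj : VirasoroAlgebra →ₗ⁅ℂ⁆ Witt where
  toFun x := ((LieAlgebra.ofProd cocycle).symm x).1
  map_add' _ _ := rfl
  map_smul' _ _ := rfl
  map_lie' := rfl

end Virasoro

/-- `p : L → Q` is a nontrivial one-dimensional central extension of `Q`: a surjective homomorphism
of Lie algebras with a one-dimensional central kernel that has no section which is a homomorphism of
Lie algebras. -/
structure IsNontrivialCentralExtension {K L Q : Type*} [Field K] [LieRing L] [LieAlgebra K L]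
    [LieRing Q] [LieAlgebra K Q] (p : L →ₗ⁅K⁆ Q) : Prop where
  surjective : Function.Surjective p
  finrank_ker : Module.finrank K p.ker = 1
  central : ∀ z x : L, p z = 0 → ⁅z, x⁆ = 0
  not_split : ¬ ∃ s : Q →ₗ⁅K⁆ L, ∀ x, p (s x) = x

end

/-!
Uniqueness: in a central extension of the Witt algebra, brackets of lifts do not depend on the
lifts, so the basis `x_m` lifts to a family `y_m` satisfying exactly the relations involving `x_0`
and the relation `[x_1, x_{-1}] = 2 x_0`. The Jacobi identity with `y_0` then kills the central
defect of every other relation of nonzero degree, and the Jacobi identity for `y_1, y_m, y_{-m-1}`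
gives a recurrence whose solution is `(m³ - m) / 12` times a fixed central element. It remains that
the Virasoro cocycle is not a coboundary.

Soficity: normally ordered quadratic expressions in the oscillators of the bosonic Fock space
represent the Virasoro algebra with `c` acting as `1`. An operator of this representation shifts
the weight by a constant, and the number of monomials of weight at most `N`, being governed by
partitions, grows subexponentially. Hence compressing to suitable balls is asymptotically
multiplicative in normalized rank, which gives a homomorphism to a metric ultraproduct that maps
`c` to `1 ≠ 0`. It is injective since every nonzero ideal of the Virasoro algebra contains `c`.
-/

noncomputable section

attribute [local instance] LieRing.ofAssociativeRing

/-! ### The Virasoro relations -/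

/-- A family `y m` (`m : ℤ`) and an element `c` of a Lie algebra satisfying the defining relations
of the Virasoro algebra. For `c = 0` these are the relations of the Witt algebra. -/
structure IsVirasoroFamily (K : Type*) {L : Type*} [Field K] [LieRing L] [LieAlgebra K L]
    (y : ℤ → L) (c : L) : Prop where
  central : ∀ m, ⁅c, y m⁆ = 0
  lie_eq : ∀ m n, ⁅y m, y n⁆ = ((m : K) - n) • y (m + n) +
    if m + n = 0 then (((m : K) ^ 3 - m) / 12) • c else 0

namespace IsVirasoroFamily

variable {K L : Type*} [Field K] [LieRing L] [LieAlgebra K L] {y : ℤ → L} {c : L}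

theorem lie_neg (h : IsVirasoroFamily K y c) (m : ℤ) :
    ⁅y m, y (-m)⁆ = (2 * m : K) • y 0 + (((m : K) ^ 3 - m) / 12) • c := by
  rw [h.lie_eq, if_pos (add_neg_cancel m), add_neg_cancel]
  push_cast
  rw [sub_neg_eq_add, two_mul]

theorem lie_eq_of_zero (h : IsVirasoroFamily K y 0) (m n : ℤ) :
    ⁅y m, y n⁆ = ((m : K) - n) • y (m + n) := by
  rw [h.lie_eq, smul_zero, ite_self, add_zero]

theorem map {L' : Type*} [LieRing L'] [LieAlgebra K L'] (h : IsVirasoroFamily K y c)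
    (φ : L →ₗ⁅K⁆ L') : IsVirasoroFamily K (fun m => φ (y m)) (φ c) where
  central m := by rw [← LieHom.map_lie, h.central, map_zero]
  lie_eq m n := by
    rw [← LieHom.map_lie, h.lie_eq, map_add, map_smul, apply_ite φ, map_smul, map_zero]

theorem of_map {L' : Type*} [LieRing L'] [LieAlgebra K L'] {φ : L →ₗ⁅K⁆ L'}
    (hφ : Function.Injective φ) (h : IsVirasoroFamily K (fun m => φ (y m)) (φ c)) :
    IsVirasoroFamily K y c where
  central m := hφ (by rw [LieHom.map_lie, h.central, map_zero])
  lie_eq m n := hφ (by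
    rw [LieHom.map_lie, h.lie_eq, map_add, map_smul, apply_ite φ, map_smul, map_zero])

end IsVirasoroFamily

namespace Virasoro

open LaurentPolynomial

/-- The coefficient of a derivation of `ℂ[t, t⁻¹]`: the derivation `f d/dt` has symbol `f`. -/
def symbol : Witt ≃ₗ[ℂ] ℂ[T;T⁻¹] where
  toFun D := D (T 1)
  map_add' _ _ := rfl
  map_smul' _ _ := rfl
  invFun f := f • ddt
  left_inv D := Derivation.ext fun f => (derivation_apply D f).symm
  right_inv f := by simp [ddt_T]

theorem symbol_lie (D E : Witt) :
    symbol ⁅D, E⁆ = symbol D * ddt (symbol E) - symbol E * ddt (symbol D) :=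
  lie_apply_T_one D E

/-- The standard basis `x_m = -t^{m+1} d/dt` of the Witt algebra. -/
def wittBasis : Module.Basis ℤ ℂ Witt :=
  ((AddMonoidAlgebra.basis ℤ ℂ).map ((symbol.trans (LinearEquiv.neg ℂ)).symm)).reindex
    (Equiv.subRight 1)

theorem symbol_wittBasis (m : ℤ) : symbol (wittBasis m) = -T (m + 1) := by
  rw [wittBasis, Module.Basis.reindex_apply, Module.Basis.map_apply, AddMonoidAlgebra.basis_apply,
    LinearEquiv.trans_symm, LinearEquiv.trans_apply, LinearEquiv.apply_symm_apply]
  rfl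

theorem isVirasoroFamily_wittBasis : IsVirasoroFamily ℂ wittBasis 0 where
  central m := zero_lie _
  lie_eq m n := symbol.injective <| by
    rw [smul_zero, ite_self, add_zero, map_smul, symbol_lie, symbol_wittBasis, symbol_wittBasis,
      symbol_wittBasis, map_neg, map_neg, ddt_T, ddt_T, neg_mul_neg, neg_mul_neg, mul_smul_comm,
      mul_smul_comm, ← T_add, ← T_add, show m + 1 + (n + 1 - 1) = m + n + 1 by ring,
      show n + 1 + (m + 1 - 1) = m + n + 1 by ring]
    push_cast
    module

/-- The Virasoro cocycle as a bilinear form on the Witt algebra. -/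
def cocycleForm : Witt →ₗ[ℂ] Witt →ₗ[ℂ] ℂ :=
  form.compl₁₂ symbol.toLinearMap symbol.toLinearMap

theorem cocycleForm_wittBasis (m n : ℤ) :
    cocycleForm (wittBasis m) (wittBasis n) = if m + n = 0 then ((m : ℂ) ^ 3 - m) / 12 else 0 := by
  have h : form (symbol (wittBasis m)) (symbol (wittBasis n)) = form (T (m + 1)) (T (n + 1)) := by
    rw [symbol_wittBasis, symbol_wittBasis, map_neg, map_neg, LinearMap.neg_apply, neg_neg]
  refine h.trans ?_
  rw [form_T]
  push_cast
  rw [add_sub_cancel_right]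
  exact if_congr (by lia) rfl rfl

theorem cocycleForm_not_coboundary :
    ¬ ∃ g : Witt →ₗ[ℂ] ℂ, ∀ D E, g ⁅D, E⁆ = cocycleForm D E := by
  rintro ⟨g, hg⟩
  have key (m : ℤ) : 2 * m * g (wittBasis 0) = ((m : ℂ) ^ 3 - m) / 12 := by
    have h := hg (wittBasis m) (wittBasis (-m))
    rwa [isVirasoroFamily_wittBasis.lie_neg, smul_zero, add_zero, map_smul, smul_eq_mul,
      cocycleForm_wittBasis, if_pos (add_neg_cancel m)] at h
  have h₁ := key 1
  have h₂ := key 2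
  push_cast at h₁ h₂
  exact absurd (show (1 : ℂ) = 0 by linear_combination 4 * h₁ - 2 * h₂) one_ne_zero

/-- The decomposition `L_V = L_W ⊕ ℂ c` of vector spaces. -/
def prodEquiv : VirasoroAlgebra ≃ₗ[ℂ] Witt × ℂ where
  toFun v := (proj v,
    TrivialLieModule.equiv ℂ Witt ℂ ((LieAlgebra.ofProd cocycle).symm v).2)
  map_add' _ _ := rfl
  map_smul' _ _ := rfl
  invFun u := LieAlgebra.ofProd cocycle (u.1, (TrivialLieModule.equiv ℂ Witt ℂ).symm u.2)
  left_inv _ := rfl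
  right_inv _ := rfl

theorem prodEquiv_fst (v : VirasoroAlgebra) : (prodEquiv v).1 = proj v := rfl

theorem prodEquiv_lie (u v : VirasoroAlgebra) :
    prodEquiv ⁅u, v⁆ = (⁅proj u, proj v⁆, cocycleForm (proj u) (proj v)) := by
  have h : (LieAlgebra.ofProd cocycle).symm ⁅u, v⁆ =
      (⁅proj u, proj v⁆, cochain (proj u) (proj v)) := by
    rw [LieAlgebra.bracket_ofTwoCocycle]
    simp only [Equiv.symm_apply_apply, trivial_lie_zero, add_zero, sub_zero]
    rfl
  exact Prod.ext (LieHom.map_lie _ _ _)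
    (congrArg (fun z : Witt × TrivialLieModule ℂ Witt ℂ => TrivialLieModule.equiv ℂ Witt ℂ z.2)
      h)

/-- The central element of the Virasoro algebra. -/
def c : VirasoroAlgebra := prodEquiv.symm (0, 1)

theorem prodEquiv_c : prodEquiv c = (0, 1) := prodEquiv.apply_symm_apply _

theorem proj_c : proj c = 0 := rfl

theorem eq_smul_c_of_proj_eq_zero {v : VirasoroAlgebra} (hv : proj v = 0) :
    v = (prodEquiv v).2 • c :=
  prodEquiv.injective <| by
    rw [map_smul, prodEquiv_c, Prod.smul_mk, smul_zero, smul_eq_mul, mul_one, ← hv, ← prodEquiv_fst]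

theorem proj_surjective : Function.Surjective proj := fun D =>
  ⟨prodEquiv.symm (D, 0), congrArg Prod.fst (prodEquiv.apply_symm_apply (D, 0))⟩

theorem finrank_ker_proj : Module.finrank ℂ proj.ker = 1 := by
  refine finrank_eq_one ⟨c, proj_c⟩ ?_ ?_
  · intro h
    have hc : prodEquiv c = 0 := congrArg prodEquiv (congrArg Subtype.val h)
    exact one_ne_zero (congrArg Prod.snd (prodEquiv_c.symm.trans hc))
  · rintro ⟨v, hv⟩
    exact ⟨_, Subtype.ext (eq_smul_c_of_proj_eq_zero hv).symm⟩

theorem lie_eq_zero_of_proj_eq_zero {z : VirasoroAlgebra} (hz : proj z = 0) (v : VirasoroAlgebra) :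
    ⁅z, v⁆ = 0 :=
  prodEquiv.injective <| by
    rw [prodEquiv_lie, hz, zero_lie (proj v), map_zero, LinearMap.zero_apply, map_zero,
      Prod.mk_zero_zero]

theorem isNontrivialCentralExtension_proj : IsNontrivialCentralExtension proj where
  surjective := proj_surjective
  finrank_ker := finrank_ker_proj
  central z x hz := lie_eq_zero_of_proj_eq_zero hz x
  not_split := by
    rintro ⟨s, hs⟩
    refine cocycleForm_not_coboundary
      ⟨LinearMap.snd ℂ Witt ℂ ∘ₗ prodEquiv.toLinearMap ∘ₗ s.toLinearMap, fun D E => ?_⟩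
    have h : prodEquiv (s ⁅D, E⁆) = (⁅D, E⁆, cocycleForm D E) := by
      rw [LieHom.map_lie, prodEquiv_lie, hs, hs]
    exact congrArg Prod.snd h

end Virasoro

namespace IsVirasoroFamily

open Virasoro

variable {L : Type*} [LieRing L] [LieAlgebra ℂ L] {y : ℤ → L} {c : L}

theorem lie_constr (h : IsVirasoroFamily ℂ y c) (D E : Witt) :
    ⁅wittBasis.constr ℂ y D, wittBasis.constr ℂ y E⁆ =
      wittBasis.constr ℂ y ⁅D, E⁆ + cocycleForm D E • c := by
  set Y := wittBasis.constr ℂ y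
  let B₁ : Witt →ₗ[ℂ] Witt →ₗ[ℂ] L := (LieModule.toEnd ℂ L L).toLinearMap.compl₁₂ Y Y
  let B₂ : Witt →ₗ[ℂ] Witt →ₗ[ℂ] L := (LieModule.toEnd ℂ Witt Witt).toLinearMap.compr₂ Y +
    cocycleForm.compr₂ (LinearMap.toSpanSingleton ℂ L c)
  have hB : B₁ = B₂ := LinearMap.ext_basis wittBasis wittBasis fun m n => by
    change ⁅Y (wittBasis m), Y (wittBasis n)⁆ =
      Y ⁅wittBasis m, wittBasis n⁆ + cocycleForm (wittBasis m) (wittBasis n) • c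
    rw [isVirasoroFamily_wittBasis.lie_eq_of_zero, map_smul, Module.Basis.constr_basis,
      Module.Basis.constr_basis, Module.Basis.constr_basis, h.lie_eq, cocycleForm_wittBasis,
      ite_smul, zero_smul]
  exact LinearMap.congr_fun₂ hB D E

theorem central_constr (h : IsVirasoroFamily ℂ y c) (D : Witt) :
    ⁅c, wittBasis.constr ℂ y D⁆ = 0 := by
  have hc : (LieModule.toEnd ℂ L L c).comp (wittBasis.constr ℂ y) = 0 :=
    wittBasis.ext fun m => (congrArg _ (wittBasis.constr_basis ℂ y m)).trans (h.central m)
  exact LinearMap.congr_fun hc D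

/-- The homomorphism from the Witt algebra given by a solution of the Witt relations. -/
def wittLift (h : IsVirasoroFamily ℂ y 0) : Witt →ₗ⁅ℂ⁆ L where
  toLinearMap := wittBasis.constr ℂ y
  map_lie' {D E} := by
    change wittBasis.constr ℂ y ⁅D, E⁆ = ⁅wittBasis.constr ℂ y D, wittBasis.constr ℂ y E⁆
    rw [h.lie_constr, smul_zero, add_zero]

/-- The homomorphism from the Virasoro algebra given by a solution of the Virasoro relations. -/
def lift (h : IsVirasoroFamily ℂ y c) : VirasoroAlgebra →ₗ⁅ℂ⁆ L where
  toLinearMap :=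
    (wittBasis.constr ℂ y).coprod (LinearMap.toSpanSingleton ℂ L c) ∘ₗ prodEquiv.toLinearMap
  map_lie' {u v} := by
    change wittBasis.constr ℂ y (prodEquiv ⁅u, v⁆).1 + (prodEquiv ⁅u, v⁆).2 • c =
      ⁅wittBasis.constr ℂ y (prodEquiv u).1 + (prodEquiv u).2 • c,
        wittBasis.constr ℂ y (prodEquiv v).1 + (prodEquiv v).2 • c⁆
    rw [prodEquiv_lie, lie_add, add_lie, add_lie, smul_lie, lie_smul, lie_smul, h.central_constr,
      ← lie_skew _ c, h.central_constr, smul_lie, lie_self, prodEquiv_fst, prodEquiv_fst,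
      h.lie_constr]
    simp only [smul_zero, neg_zero, add_zero]

theorem lift_apply (h : IsVirasoroFamily ℂ y c) (v : VirasoroAlgebra) :
    h.lift v = wittBasis.constr ℂ y (proj v) + (prodEquiv v).2 • c := rfl

theorem lift_c (h : IsVirasoroFamily ℂ y c) : h.lift Virasoro.c = c := by
  rw [lift_apply, proj_c, prodEquiv_c, map_zero, zero_add, one_smul]

end IsVirasoroFamily

/-! ### Uniqueness of the central extension -/

section Uniqueness

variable {K L : Type*} [Field K] [LieRing L] [LieAlgebra K L]

variable (K) in
/-- The deviation of a family `y` in a Lie algebra from the Witt relations. -/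
def wittDefect (y : ℤ → L) (m n : ℤ) : L := ⁅y m, y n⁆ - ((m : K) - n) • y (m + n)

theorem lie_eq_add_wittDefect (y : ℤ → L) (m n : ℤ) :
    ⁅y m, y n⁆ = ((m : K) - n) • y (m + n) + wittDefect K y m n :=
  (add_sub_cancel _ _).symm

theorem wittDefect_swap (y : ℤ → L) (m n : ℤ) : wittDefect K y n m = -wittDefect K y m n := by
  rw [wittDefect, wittDefect, ← lie_skew, add_comm n m]
  module

variable (K) in
/-- A family satisfying the Witt relations up to central elements, normalized so that its
brackets with `y 0` and the bracket of `y 1` and `y (-1)` are exactly those of the Witt algebra. -/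
structure IsNormalizedProjectiveWittFamily (y : ℤ → L) : Prop where
  wittDefect_lie : ∀ (m n : ℤ) (x : L), ⁅wittDefect K y m n, x⁆ = 0
  lie_zero : ∀ m, ⁅y m, y 0⁆ = (m : K) • y m
  lie_one_neg_one : ⁅y 1, y (-1)⁆ = (2 : K) • y 0

theorem eq_cube_sub_self_smul_of_recurrence [CharZero K] {M : Type*} [AddCommGroup M] [Module K M]
    {f : ℕ → M} (h₁ : f 1 = 0)
    (hf : ∀ m : ℕ, ((m : K) - 1) • f (m + 1) = ((m : K) + 2) • f m) (m : ℕ) :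
    f m = (((m : K) ^ 3 - m) / 6) • f 2 := by
  match m with
  | 0 =>
    have h₀ := hf 0
    rw [zero_add, h₁, smul_zero, Nat.cast_zero, zero_add] at h₀
    simpa using h₀.symm
  | 1 => simp [h₁]
  | m + 2 =>
    induction m with
    | zero => norm_num
    | succ m ih =>
      have hm : (m : K) + 1 ≠ 0 := Nat.cast_add_one_ne_zero m
      have h := hf (m + 2)
      rw [ih, smul_smul] at h
      push_cast at h ⊢
      rw [show (m : K) + 2 - 1 = m + 1 by ring] at h
      rw [show m + 1 + 2 = m + 2 + 1 by ring, ← inv_smul_smul₀ hm (f (m + 2 + 1)), h, smul_smul]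
      congr 1
      field_simp
      ring

namespace IsNormalizedProjectiveWittFamily

variable {y : ℤ → L}

theorem lie_wittDefect (h : IsNormalizedProjectiveWittFamily K y) (m n : ℤ) (x : L) :
    ⁅x, wittDefect K y m n⁆ = 0 := by
  rw [← lie_skew, h.wittDefect_lie, neg_zero]

theorem zero_lie (h : IsNormalizedProjectiveWittFamily K y) (m : ℤ) :
    ⁅y 0, y m⁆ = -((m : K) • y m) := by
  rw [← lie_skew, h.lie_zero]

theorem wittDefect_eq_zero [CharZero K] (h : IsNormalizedProjectiveWittFamily K y) {m n : ℤ}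
    (hmn : m + n ≠ 0) : wittDefect K y m n = 0 := by
  have jacobi := leibniz_lie (y 0) (y m) (y n)
  rw [h.zero_lie, h.zero_lie, lie_eq_add_wittDefect (K := K) y m n, lie_add, h.lie_wittDefect,
    lie_smul, h.zero_lie, neg_lie, lie_neg, smul_lie, lie_smul,
    lie_eq_add_wittDefect (K := K) y m n] at jacobi
  have hdegree : ((m + n : ℤ) : K) • wittDefect K y m n = 0 := by
    push_cast at jacobi ⊢
    linear_combination (norm := module) jacobi
  exact (smul_eq_zero.mp hdegree).resolve_left (Int.cast_ne_zero.mpr hmn)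

theorem wittDefect_one_neg_one (h : IsNormalizedProjectiveWittFamily K y) :
    wittDefect K y 1 (-1) = 0 := by
  rw [wittDefect, h.lie_one_neg_one, add_neg_cancel]
  push_cast
  module

theorem wittDefect_recurrence (h : IsNormalizedProjectiveWittFamily K y) (m : ℤ) :
    ((m : K) - 1) • wittDefect K y (m + 1) (-(m + 1)) =
      ((m : K) + 2) • wittDefect K y m (-m) := by
  have jacobi := leibniz_lie (y 1) (y m) (y (-(m + 1)))
  rw [lie_eq_add_wittDefect (K := K) y m, lie_eq_add_wittDefect (K := K) y 1 m,
    lie_eq_add_wittDefect (K := K) y 1 (-(m + 1)), lie_add, lie_add, add_lie, h.lie_wittDefect,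
    h.lie_wittDefect, h.wittDefect_lie, lie_smul, lie_smul, smul_lie,
    show m + -(m + 1) = -1 by ring, show 1 + -(m + 1) = -m by ring, add_comm 1 m,
    h.lie_one_neg_one, lie_eq_add_wittDefect (K := K) y (m + 1),
    lie_eq_add_wittDefect (K := K) y m, add_neg_cancel, add_neg_cancel] at jacobi
  push_cast at jacobi
  linear_combination (norm := module) jacobi

theorem wittDefect_neg [CharZero K] (h : IsNormalizedProjectiveWittFamily K y) (m : ℤ) :
    wittDefect K y m (-m) = (((m : K) ^ 3 - m) / 6) • wittDefect K y 2 (-2) := by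
  have hnat (k : ℕ) : wittDefect K y k (-k) = (((k : K) ^ 3 - k) / 6) • wittDefect K y 2 (-2) :=
    eq_cube_sub_self_smul_of_recurrence (f := fun k => wittDefect K y k (-k))
      h.wittDefect_one_neg_one (fun k => mod_cast h.wittDefect_recurrence k) k
  obtain ⟨k, rfl | rfl⟩ := m.eq_nat_or_neg
  · exact_mod_cast hnat k
  · rw [neg_neg, wittDefect_swap, hnat]
    push_cast
    module

theorem isVirasoroFamily [CharZero K] (h : IsNormalizedProjectiveWittFamily K y) :
    IsVirasoroFamily K y ((2 : K) • wittDefect K y 2 (-2)) where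
  central m := by rw [smul_lie, h.wittDefect_lie, smul_zero]
  lie_eq m n := by
    rw [lie_eq_add_wittDefect (K := K)]
    congr 1
    split_ifs with hmn
    · obtain rfl : n = -m := by lia
      rw [h.wittDefect_neg, smul_smul]
      congr 1
      ring
    · exact h.wittDefect_eq_zero hmn

end IsNormalizedProjectiveWittFamily

variable {Q : Type*} [LieRing Q] [LieAlgebra K Q] {p : L →ₗ⁅K⁆ Q}

theorem lie_congr_of_central (hp : ∀ z x : L, p z = 0 → ⁅z, x⁆ = 0) {a a' b b' : L}
    (ha : p a = p a') (hb : p b = p b') : ⁅a, b⁆ = ⁅a', b'⁆ := by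
  have hl : ⁅a - a', b⁆ = 0 := hp _ _ (by rw [map_sub, ha, sub_self])
  have hr : ⁅b - b', a'⁆ = 0 := hp _ _ (by rw [map_sub, hb, sub_self])
  rw [sub_lie, sub_eq_zero] at hl hr
  rw [hl, ← lie_skew, hr, lie_skew]

theorem map_wittDefect_eq_zero {x : ℤ → Q} (hx : IsVirasoroFamily K x 0) {y : ℤ → L}
    (hy : ∀ m, p (y m) = x m) (m n : ℤ) : p (wittDefect K y m n) = 0 := by
  rw [wittDefect, map_sub, LieHom.map_lie, map_smul, hy, hy, hy, hx.lie_eq_of_zero, sub_self]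

theorem exists_isNormalizedProjectiveWittFamily [CharZero K] (hsurj : Function.Surjective p)
    (hcent : ∀ z x : L, p z = 0 → ⁅z, x⁆ = 0) {x : ℤ → Q} (hx : IsVirasoroFamily K x 0) :
    ∃ y : ℤ → L, (∀ m, p (y m) = x m) ∧ IsNormalizedProjectiveWittFamily K y := by
  -- Brackets of lifts do not depend on the lifts, so that `⁅y m, y n⁆ = ⁅u m, u n⁆` below.
  choose u hu using fun m => hsurj (x m)
  let y : ℤ → L := fun m => if m = 0 then (2 : K)⁻¹ • ⁅u 1, u (-1)⁆ else (m : K)⁻¹ • ⁅u m, u 0⁆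
  have hcast {m : ℤ} (hm : m ≠ 0) : (m : K) ≠ 0 := Int.cast_ne_zero.mpr hm
  have hy (m : ℤ) : p (y m) = x m := by
    by_cases hm : m = 0
    · simp only [y, hm, if_true, map_smul, LieHom.map_lie, hu, hx.lie_neg 1, smul_zero, add_zero,
        Int.cast_one, mul_one]
      exact inv_smul_smul₀ two_ne_zero _
    · simp only [y, hm, if_false, map_smul, LieHom.map_lie, hu, hx.lie_eq_of_zero, Int.cast_zero,
        sub_zero, add_zero]
      exact inv_smul_smul₀ (hcast hm) _
  have hyu (m n : ℤ) : ⁅y m, y n⁆ = ⁅u m, u n⁆ :=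
    lie_congr_of_central hcent ((hy m).trans (hu m).symm) ((hy n).trans (hu n).symm)
  refine ⟨y, hy, fun m n z => hcent _ z (map_wittDefect_eq_zero hx hy m n), fun m => ?_, ?_⟩
  · by_cases hm : m = 0
    · rw [hm, lie_self, Int.cast_zero, zero_smul]
    · rw [hyu]
      simp only [y, hm, if_false]
      exact (smul_inv_smul₀ (hcast hm) _).symm
  · rw [hyu]
    exact (smul_inv_smul₀ two_ne_zero _).symm

theorem exists_isVirasoroFamily_of_centralExtension [CharZero K] (hsurj : Function.Surjective p)
    (hcent : ∀ z x : L, p z = 0 → ⁅z, x⁆ = 0) {x : ℤ → Q} (hx : IsVirasoroFamily K x 0) :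
    ∃ (y : ℤ → L) (w : L), (∀ m, p (y m) = x m) ∧ p w = 0 ∧ IsVirasoroFamily K y w := by
  obtain ⟨y, hy, h⟩ := exists_isNormalizedProjectiveWittFamily hsurj hcent hx
  exact ⟨y, _, hy, by rw [map_smul, map_wittDefect_eq_zero hx hy, smul_zero], h.isVirasoroFamily⟩

end Uniqueness

theorem bijective_of_comp_eq_of_finrank_ker_eq_one {K M M' Q : Type*} [Field K] [AddCommGroup M]
    [Module K M] [AddCommGroup M'] [Module K M'] [AddCommGroup Q] [Module K Q] {p : M →ₗ[K] Q}
    {p' : M' →ₗ[K] Q} {f : M →ₗ[K] M'} (hf : p' ∘ₗ f = p) (hp : Function.Surjective p)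
    (hker : Module.finrank K p.ker = 1) (hker' : Module.finrank K p'.ker = 1) {z : M}
    (hz : p z = 0) (hfz : f z ≠ 0) : Function.Bijective f := by
  have hpf (v : M) : p' (f v) = p v := LinearMap.congr_fun hf v
  have hz₀ : z ≠ 0 := fun h => hfz (by rw [h, map_zero])
  have hspan := (finrank_eq_one_iff_of_nonzero' (⟨z, hz⟩ : p.ker)
    (fun h => hz₀ (congrArg Subtype.val h))).mp hker
  have hspan' := (finrank_eq_one_iff_of_nonzero' (⟨f z, (hpf z).trans hz⟩ : p'.ker)
    (fun h => hfz (congrArg Subtype.val h))).mp hker'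
  constructor
  · rw [injective_iff_map_eq_zero]
    intro v hv
    obtain ⟨a, ha⟩ := hspan ⟨v, by rw [LinearMap.mem_ker, ← hpf, hv, map_zero]⟩
    obtain rfl : a • z = v := congrArg Subtype.val ha
    rw [map_smul] at hv
    rw [(smul_eq_zero.mp hv).resolve_right hfz, zero_smul]
  · intro x
    obtain ⟨v, hv⟩ := hp (p' x)
    obtain ⟨a, ha⟩ := hspan' ⟨x - f v, by rw [LinearMap.mem_ker, map_sub, hpf, hv, sub_self]⟩
    have ha' : a • f z = x - f v := congrArg Subtype.val ha
    exact ⟨v + a • z, by rw [map_add, map_smul, ha', add_sub_cancel]⟩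

namespace Virasoro

variable {L : Type*} [LieRing L] [LieAlgebra ℂ L] {p : L →ₗ⁅ℂ⁆ Witt}

theorem map_constr_wittBasis {y : ℤ → L} (hy : ∀ m, p (y m) = wittBasis m) (D : Witt) :
    p (wittBasis.constr ℂ y D) = D := by
  have h : p.toLinearMap ∘ₗ wittBasis.constr ℂ y = LinearMap.id :=
    wittBasis.ext fun m => (congrArg p (wittBasis.constr_basis ℂ y m)).trans (hy m)
  exact LinearMap.congr_fun h D

theorem exists_equiv_of_isNontrivialCentralExtension (hp : IsNontrivialCentralExtension p) :
    ∃ e : L ≃ₗ⁅ℂ⁆ VirasoroAlgebra, ∀ x, proj (e x) = p x := by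
  obtain ⟨y, w, hy, hw, h⟩ := exists_isVirasoroFamily_of_centralExtension hp.surjective hp.central
    isVirasoroFamily_wittBasis
  have hw₀ : w ≠ 0 := by
    rintro rfl
    exact hp.not_split ⟨h.wittLift, map_constr_wittBasis hy⟩
  have hproj (v : VirasoroAlgebra) : p (h.lift v) = proj v := by
    rw [h.lift_apply, map_add, map_smul, hw, smul_zero, add_zero, map_constr_wittBasis hy]
  have hbij : Function.Bijective h.lift :=
    bijective_of_comp_eq_of_finrank_ker_eq_one (f := h.lift.toLinearMap) (LinearMap.ext hproj)
      proj_surjective finrank_ker_proj hp.finrank_ker proj_c (by rwa [← h.lift_c] at hw₀)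
  let e := LieEquiv.ofBijective h.lift hbij
  exact ⟨e.symm, fun x => by rw [← hproj]; exact congrArg p (e.apply_symm_apply x)⟩

end Virasoro

/-! ### Ideals -/

section Simplicity

theorem aeval_mem_of_mapsTo {K V : Type*} [CommSemiring K] [AddCommMonoid V] [Module K V]
    {A : Module.End K V} {N : Submodule K V} (hN : Set.MapsTo A N N) (P : Polynomial K) {v : V}
    (hv : v ∈ N) : Polynomial.aeval A P v ∈ N := by
  rw [Polynomial.aeval_eq_sum_range, LinearMap.sum_apply]
  refine N.sum_mem fun k _ => N.smul_mem _ ?_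
  rw [Module.End.pow_apply]
  exact hN.iterate k hv

theorem repr_smul_mem_of_mapsTo {K V ι : Type*} [Field K] [AddCommGroup V] [Module K V]
    (b : Module.Basis ι K V) {A : Module.End K V} {a : ι → K} (ha : Function.Injective a)
    (hA : ∀ i, A (b i) = a i • b i) {N : Submodule K V} (hN : Set.MapsTo A N N) {v : V}
    (hv : v ∈ N) (i : ι) : b.repr v i • b i ∈ N := by
  classical
  by_cases hi : i ∈ (b.repr v).support
  · set s := (b.repr v).support
    -- `P (A)` is the projection to the `i`-th coordinate on the span of the support of `v`.
    set P := Lagrange.basis s a i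
    have hP (j : ι) : Polynomial.aeval A P (b j) = P.eval (a j) • b j :=
      Module.End.aeval_apply_of_hasEigenvector
        ⟨Module.End.mem_eigenspace_iff.mpr (hA j), b.ne_zero j⟩
    have hPv : Polynomial.aeval A P v = b.repr v i • b i := by
      conv_lhs => rw [← b.linearCombination_repr v, Finsupp.linearCombination_apply, Finsupp.sum,
        map_sum]
      rw [Finset.sum_eq_single_of_mem i hi, map_smul, hP,
        Lagrange.eval_basis_self ha.injOn hi, one_smul]
      intro j hj hji
      rw [map_smul, hP, Lagrange.eval_basis_of_ne hji.symm hj, zero_smul, smul_zero]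
    exact hPv ▸ aeval_mem_of_mapsTo hN P hv
  · rw [Finsupp.notMem_support_iff.mp hi, zero_smul]
    exact N.zero_mem

variable {K L : Type*} [Field K] [CharZero K] [LieRing L] [LieAlgebra K L]

theorem IsVirasoroFamily.lieIdeal_eq_top {b : Module.Basis ℤ K L} (h : IsVirasoroFamily K b 0)
    {I : LieIdeal K L} (hI : I ≠ ⊥) : I = ⊤ := by
  have of_mem {i j : ℤ} (hi : b i ∈ I) (hj : j ≠ 2 * i) : b j ∈ I := by
    have hlie : ⁅b (j - i), b i⁆ = ((j - 2 * i : ℤ) : K) • b j := by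
      rw [h.lie_eq_of_zero, sub_add_cancel]
      push_cast
      ring_nf
    exact ((I : Submodule K L).smul_mem_iff (Int.cast_ne_zero.mpr (sub_ne_zero.mpr hj))).mp
      (hlie ▸ lie_mem_right K L I _ _ hi)
  have hEuler (i : ℤ) : LieModule.toEnd K L L (b 0) (b i) = (-i : K) • b i :=
    (h.lie_eq_of_zero 0 i).trans (by rw [Int.cast_zero, zero_sub, zero_add])
  obtain ⟨v, hv, hv₀⟩ := (Submodule.ne_bot_iff _).mp
    ((LieSubmodule.toSubmodule_eq_bot I).not.mpr hI)
  obtain ⟨i, hi⟩ : ∃ i, b.repr v i ≠ 0 := by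
    by_contra! hzero
    exact hv₀ (b.repr.map_eq_zero_iff.mp (Finsupp.ext hzero))
  have hbi : b i ∈ I := ((I : Submodule K L).smul_mem_iff hi).mp <|
    repr_smul_mem_of_mapsTo b (neg_injective.comp Int.cast_injective) hEuler
      (fun _ hx => lie_mem_right K L I _ _ hx) hv i
  have hb₀ : b 0 ∈ I := by
    by_cases hi₀ : i = 0
    · exact hi₀ ▸ hbi
    · exact of_mem hbi (by lia)
  have hb (j : ℤ) : b j ∈ I := by
    by_cases hj : j = 0
    · exact hj ▸ hb₀
    · exact of_mem hb₀ (by lia)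
  rw [← LieSubmodule.toSubmodule_inj, LieSubmodule.top_toSubmodule, eq_top_iff, ← b.span_eq,
    Submodule.span_le]
  exact Set.range_subset_iff.mpr hb

end Simplicity

namespace Virasoro

theorem isVirasoroFamily_generators :
    IsVirasoroFamily ℂ (fun m => prodEquiv.symm (wittBasis m, 0)) c where
  central m := lie_eq_zero_of_proj_eq_zero proj_c _
  lie_eq m n := prodEquiv.injective <| by
    have hproj (m : ℤ) : proj (prodEquiv.symm (wittBasis m, 0)) = wittBasis m :=
      congrArg Prod.fst (prodEquiv.apply_symm_apply (wittBasis m, 0))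
    rw [prodEquiv_lie, hproj, hproj, isVirasoroFamily_wittBasis.lie_eq_of_zero,
      cocycleForm_wittBasis, map_add prodEquiv, map_smul, prodEquiv.apply_symm_apply,
      apply_ite prodEquiv, map_smul, prodEquiv_c, map_zero]
    split_ifs <;> simp

theorem c_mem_of_lieIdeal_ne_bot {I : LieIdeal ℂ VirasoroAlgebra} (hI : I ≠ ⊥) : c ∈ I := by
  by_cases hmap : I.map proj = ⊥
  · obtain ⟨v, hv, hv₀⟩ := (Submodule.ne_bot_iff _).mp
      ((LieSubmodule.toSubmodule_eq_bot I).not.mpr hI)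
    have hpv : proj v = 0 := (LieSubmodule.mem_bot _).mp (hmap ▸ LieIdeal.mem_map hv)
    have hvc := eq_smul_c_of_proj_eq_zero hpv
    have ha : (prodEquiv v).2 ≠ 0 := fun h => hv₀ (by rw [hvc, h, zero_smul])
    exact ((I : Submodule ℂ VirasoroAlgebra).smul_mem_iff ha).mp (hvc ▸ hv)
  · have htop : I.map proj = ⊤ := isVirasoroFamily_wittBasis.lieIdeal_eq_top hmap
    set x : ℤ → VirasoroAlgebra := fun m => prodEquiv.symm (wittBasis m, 0)
    have hlie (m n : ℤ) : ⁅x m, x n⁆ ∈ I := by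
      obtain ⟨⟨u, hu⟩, hux⟩ := LieIdeal.mem_map_of_surjective proj_surjective
        (htop ▸ LieSubmodule.mem_top (proj (x m)) : proj (x m) ∈ I.map proj)
      rw [← lie_congr_of_central (fun z v hz => lie_eq_zero_of_proj_eq_zero hz v) hux rfl]
      exact lie_mem_left ℂ VirasoroAlgebra I _ _ hu
    have hc : c = (2 : ℂ) • ⁅x 2, x (-2)⁆ - (4 : ℂ) • ⁅x 1, x (-1)⁆ := by
      rw [isVirasoroFamily_generators.lie_neg, isVirasoroFamily_generators.lie_neg]
      push_cast
      module
    rw [hc]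
    exact sub_mem (I.smul_mem _ (hlie _ _)) (I.smul_mem _ (hlie _ _))

theorem injective_of_map_c_ne_zero {L : Type*} [LieRing L] [LieAlgebra ℂ L]
    {φ : VirasoroAlgebra →ₗ⁅ℂ⁆ L} (hφ : φ c ≠ 0) : Function.Injective φ := by
  rw [← LieHom.ker_eq_bot]
  by_contra hker
  exact hφ (c_mem_of_lieIdeal_ne_bot hker)

end Virasoro

/-! ### The Fock space -/

section Derivation

open MvPolynomial

variable {σ R : Type*} [CommRing R]

theorem lie_derivation_mulLeft {A : Type*} [CommRing A] [Algebra R A] (D : Derivation R A A)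
    (a : A) : ⁅(D : Module.End R A), LinearMap.mulLeft R a⁆ = LinearMap.mulLeft R (D a) := by
  refine LinearMap.ext fun b => ?_
  simp only [Ring.lie_def, LinearMap.sub_apply, Module.End.mul_apply, LinearMap.mulLeft_apply,
    Derivation.coeFn_coe, Derivation.leibniz, smul_eq_mul]
  ring

theorem lie_mulLeft_mulLeft {A : Type*} [CommRing A] [Algebra R A] (a b : A) :
    ⁅LinearMap.mulLeft R a, LinearMap.mulLeft R b⁆ = 0 := by
  rw [Ring.lie_def, Module.End.mul_eq_comp, Module.End.mul_eq_comp, ← LinearMap.mulLeft_mul,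
    ← LinearMap.mulLeft_mul, mul_comm, sub_self]

theorem lie_pderiv_pderiv (i j : σ) :
    ⁅(pderiv i : Derivation R (MvPolynomial σ R) (MvPolynomial σ R)),
      (pderiv j : Derivation R (MvPolynomial σ R) (MvPolynomial σ R))⁆ = 0 := by
  classical
  refine derivation_ext fun k => ?_
  rw [Derivation.commutator_apply, pderiv_X, pderiv_X]
  simp [Pi.single_apply, apply_ite]

theorem lie_pderiv_mulLeft_X [DecidableEq σ] (i j : σ) :
    ⁅(pderiv i : Derivation R (MvPolynomial σ R) (MvPolynomial σ R)).toLinearMap,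
      LinearMap.mulLeft R (X j : MvPolynomial σ R)⁆ = if i = j then 1 else 0 := by
  rw [lie_derivation_mulLeft, pderiv_X, Pi.single_apply]
  rcases eq_or_ne i j with rfl | h
  · simp [Module.End.one_eq_id]
  · simp [h, h.symm]

theorem eq_C_of_pderiv_eq_zero [NoZeroDivisors R] [CharZero R] {f : MvPolynomial σ R}
    (h : ∀ k, pderiv k f = 0) : f = C (constantCoeff f) := by
  classical
  ext d
  rw [coeff_C]
  split_ifs with hd
  · rw [← hd]
    rfl
  · obtain ⟨k, hk⟩ := Finsupp.ne_iff.mp (Ne.symm hd)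
    have hcoeff := coeff_pderiv (i := k) f (d - Finsupp.single k 1)
    rw [h, coeff_zero, tsub_add_cancel_of_le
      (Finsupp.single_le_iff.mpr (Nat.one_le_iff_ne_zero.mpr hk))] at hcoeff
    exact (mul_eq_zero.mp hcoeff.symm).resolve_right (Nat.cast_add_one_ne_zero _)

end Derivation

theorem eq_zero_or_eq_succ_or_eq_neg_succ (n : ℤ) :
    n = 0 ∨ (∃ k : ℕ, n = k + 1) ∨ ∃ k : ℕ, n = -(k + 1) := by
  rcases lt_trichotomy n 0 with h | h | h
  · exact Or.inr (Or.inr ⟨(-n - 1).toNat, by lia⟩)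
  · exact Or.inl h
  · exact Or.inr (Or.inl ⟨(n - 1).toNat, by lia⟩)

namespace Fock

open MvPolynomial

section CommRing

variable (R : Type*) [CommRing R]

/-- The bosonic Fock space `R[X₀, X₁, …]`. -/
abbrev Space : Type _ := MvPolynomial ℕ R

/-- The oscillators `a_m` on the Fock space, at charge zero: `a_{-(k+1)}` is multiplication by
`X_k`, `a_{k+1}` is `(k+1) ∂/∂X_k`, and `a_0 = 0`. -/
def osc : ℤ → Module.End R (Space R)
  | .ofNat 0 => 0
  | .ofNat (k + 1) => ((k : R) + 1) • (pderiv k : Derivation R (Space R) (Space R)).toLinearMap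
  | .negSucc k => LinearMap.mulLeft R (X k)

@[simp]
theorem osc_zero : osc R 0 = 0 := rfl

theorem osc_pos (k : ℕ) : osc R ((k : ℤ) + 1) =
    ((k : R) + 1) • (pderiv k : Derivation R (Space R) (Space R)).toLinearMap := rfl

theorem osc_neg (k : ℕ) : osc R (-((k : ℤ) + 1)) = LinearMap.mulLeft R (X k) := by
  rw [← Int.negSucc_eq]
  rfl

variable {R}

theorem osc_lie_of_pos_of_neg (i j : ℕ) : ⁅osc R ((i : ℤ) + 1), osc R (-((j : ℤ) + 1))⁆ =
    if i = j then ((i : R) + 1) • 1 else 0 := by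
  rw [osc_pos, osc_neg, smul_lie (L := Module.End R (Space R)), lie_pderiv_mulLeft_X, smul_ite,
    smul_zero]

theorem osc_lie (m n : ℤ) :
    ⁅osc R m, osc R n⁆ = if m + n = 0 then (m : R) • 1 else 0 := by
  rcases eq_zero_or_eq_succ_or_eq_neg_succ m with rfl | ⟨i, rfl⟩ | ⟨i, rfl⟩ <;>
    rcases eq_zero_or_eq_succ_or_eq_neg_succ n with rfl | ⟨j, rfl⟩ | ⟨j, rfl⟩
  · simp
  · simp
  · simp
  · rw [osc_zero, lie_zero, if_neg (by lia)]
  · rw [if_neg (by lia), osc_pos, osc_pos, smul_lie (L := Module.End R (Space R)),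
      lie_smul (M := Module.End R (Space R)),
      ← Derivation.commutator_coe_linear_map, lie_pderiv_pderiv, Derivation.coe_zero_linearMap,
      smul_zero, smul_zero]
  · rw [osc_lie_of_pos_of_neg]
    split_ifs <;> first | lia | simp
  · rw [osc_zero, lie_zero, if_neg (by lia)]
  · rw [← lie_skew, osc_lie_of_pos_of_neg]
    rcases eq_or_ne j i with rfl | hji
    · rw [if_pos rfl, if_pos (by lia)]
      push_cast
      module
    · rw [if_neg hji, if_neg (by lia), neg_zero]
  · rw [osc_neg, osc_neg, lie_mulLeft_mulLeft, if_neg (by lia)]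

theorem osc_one_of_nonneg {j : ℤ} (hj : 0 ≤ j) : osc R j 1 = 0 := by
  rcases eq_zero_or_eq_succ_or_eq_neg_succ j with rfl | ⟨i, rfl⟩ | ⟨i, rfl⟩
  · simp
  · simp [osc_pos]
  · lia

theorem osc_neg_one (k : ℕ) : osc R (-((k : ℤ) + 1)) 1 = X k := by
  rw [osc_neg, LinearMap.mulLeft_apply, mul_one]

theorem pderiv_osc_one (k : ℕ) (j : ℤ) :
    pderiv k (osc R j 1) = if j = -(k + 1) then 1 else 0 := by
  rcases le_or_gt 0 j with hj | hj
  · rw [osc_one_of_nonneg hj, if_neg (by lia), map_zero]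
  · obtain ⟨i, rfl⟩ : ∃ i : ℕ, j = -(i + 1) := ⟨(-j - 1).toNat, by lia⟩
    rw [osc_neg_one, pderiv_X, Pi.single_apply]
    exact if_congr (by lia) rfl rfl

theorem constantCoeff_osc {j : ℤ} (hj : j < 0) (f : Space R) :
    constantCoeff (osc R j f) = 0 := by
  obtain ⟨k, rfl⟩ : ∃ k : ℕ, j = -(k + 1) := ⟨(-j - 1).toNat, by lia⟩
  simp only [osc_neg, LinearMap.mulLeft_apply, map_mul, constantCoeff_X, zero_mul]

variable (R) in
/-- The derivation `X_k ↦ (k + 1) a_{m-k-1} 1` of the Fock space: the part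
`∑_{i > max 0 m} a_{m-i} a_i` of the `m`-th Virasoro operator. -/
def shift (m : ℤ) : Derivation R (Space R) (Space R) :=
  mkDerivation R fun k => ((k : R) + 1) • osc R (m - k - 1) 1

theorem shift_X (m : ℤ) (k : ℕ) : shift R m (X k) = ((k : R) + 1) • osc R (m - k - 1) 1 :=
  mkDerivation_X _ _ _

theorem shift_lie_osc_of_neg (m : ℤ) {n : ℤ} (hn : n < 0) :
    ⁅(shift R m).toLinearMap, osc R n⁆ = if m + n < 0 then (-n : R) • osc R (m + n) else 0 := by
  obtain ⟨k, rfl⟩ : ∃ k : ℕ, n = -(k + 1) := ⟨(-n - 1).toNat, by lia⟩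
  rw [osc_neg, lie_derivation_mulLeft, shift_X]
  split_ifs with hmn
  · obtain ⟨r, hr⟩ : ∃ r : ℕ, m + -((k : ℤ) + 1) = -(r + 1) := ⟨(-m + k).toNat, by lia⟩
    rw [hr, show m - k - 1 = -((r : ℤ) + 1) by lia, osc_neg_one, osc_neg]
    refine LinearMap.ext fun g => ?_
    simp
  · rw [osc_one_of_nonneg (by lia), smul_zero, LinearMap.mulLeft_zero_eq_zero]

theorem shift_lie_pderiv_X (m : ℤ) (k l : ℕ) :
    ⁅shift R m, (pderiv k : Derivation R (Space R) (Space R))⁆ (X l) =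
    if m - l - 1 = -(k + 1) then -((l : R) + 1) • 1 else 0 := by
  have hconst : shift R m ((Pi.single k 1 : ℕ → Space R) l) = 0 := by
    rw [Pi.single_apply, apply_ite (shift R m)]
    simp
  rw [Derivation.commutator_apply, pderiv_X, hconst, shift_X, Derivation.map_smul, pderiv_osc_one,
    zero_sub, smul_ite, smul_zero, neg_smul]
  split_ifs
  · rfl
  · exact neg_zero

theorem shift_lie_osc_of_pos (m : ℤ) {n : ℤ} (hn : 0 < n) :
    ⁅(shift R m).toLinearMap, osc R n⁆ = if 0 < m + n then (-n : R) • osc R (m + n) else 0 := by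
  obtain ⟨k, rfl⟩ : ∃ k : ℕ, n = k + 1 := ⟨(n - 1).toNat, by lia⟩
  rw [osc_pos, lie_smul (M := Module.End R (Space R)), ← Derivation.commutator_coe_linear_map]
  split_ifs with hmn
  · obtain ⟨r, hr⟩ : ∃ r : ℕ, m + k = r := Int.eq_ofNat_of_zero_le (by lia)
    have hshift : ⁅shift R m, (pderiv k : Derivation R (Space R) (Space R))⁆ =
        -((r : R) + 1) • pderiv r := by
      refine derivation_ext fun l => ?_
      rw [shift_lie_pderiv_X, Derivation.smul_apply, pderiv_X, Pi.single_apply, smul_ite, smul_zero]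
      refine ite_congr (by simp only [eq_iff_iff]; lia) (fun hl => ?_) fun _ => rfl
      rw [hl]
    rw [hshift, show m + ((k : ℤ) + 1) = r + 1 by lia, osc_pos, Derivation.coe_smul_linearMap]
    push_cast
    module
  · have hshift : ⁅shift R m, (pderiv k : Derivation R (Space R) (Space R))⁆ = 0 := by
      refine derivation_ext fun l => ?_
      rw [shift_lie_pderiv_X, if_neg (by lia), Derivation.zero_apply]
    rw [hshift, Derivation.coe_zero_linearMap, smul_zero]

theorem shift_lie_osc (m n : ℤ) : ⁅(shift R m).toLinearMap, osc R n⁆ =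
    if -n ∈ Finset.Ioo (min 0 m) (max 0 m) then 0 else (-n : R) • osc R (m + n) := by
  rcases eq_or_ne (m + n) 0 with hmn | hmn
  · rw [hmn, osc_zero, smul_zero, ite_self]
    rcases lt_trichotomy n 0 with hn | rfl | hn
    · rw [shift_lie_osc_of_neg m hn, if_neg (by lia)]
    · rw [osc_zero, lie_zero]
    · rw [shift_lie_osc_of_pos m hn, if_neg (by lia)]
  · simp only [Finset.mem_Ioo]
    rcases lt_trichotomy n 0 with hn | rfl | hn
    · rw [shift_lie_osc_of_neg m hn, ← ite_not]
      exact if_congr (by lia) rfl rfl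
    · simp
    · rw [shift_lie_osc_of_pos m hn, ← ite_not]
      exact if_congr (by lia) rfl rfl

theorem osc_mul_osc_lie_osc (m n i : ℤ) : ⁅osc R i * osc R (m - i), osc R n⁆ =
    (if m + n = i then (-n : R) • osc R (m + n) else 0) +
      if -n = i then (-n : R) • osc R (m + n) else 0 := by
  have leibniz : ⁅osc R i * osc R (m - i), osc R n⁆ =
      osc R i * ⁅osc R (m - i), osc R n⁆ + ⁅osc R i, osc R n⁆ * osc R (m - i) := by
    simp only [Ring.lie_def, mul_sub, sub_mul, mul_assoc]
    abel
  rw [leibniz, osc_lie, osc_lie, mul_ite, ite_mul, mul_smul_comm, mul_one, smul_mul_assoc, one_mul,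
    mul_zero, zero_mul]
  congr 1
  · refine ite_congr (by simp only [eq_iff_iff]; lia) (fun hi => ?_) fun _ => rfl
    rw [← hi]
    push_cast
    module
  · refine ite_congr (by simp only [eq_iff_iff]; lia) (fun hi => ?_) fun _ => rfl
    rw [← hi, sub_neg_eq_add, Int.cast_neg]

/-- The weight of a monomial of the Fock space, in which `X_k` has weight `k + 1`. -/
def wt : (ℕ →₀ ℕ) →+ ℕ := Finsupp.weight fun k => k + 1

theorem wt_single (k e : ℕ) : wt (Finsupp.single k e) = e * (k + 1) := by
  simp [wt, Finsupp.weight_single]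

theorem shift_zero_monomial (σ : ℕ →₀ ℕ) :
    shift R 0 (monomial σ 1) = (wt σ : R) • monomial σ 1 := by
  induction σ using Finsupp.induction_linear with
  | zero => simp
  | add σ τ hσ hτ =>
    have hmul : (monomial (σ + τ) 1 : Space R) = monomial σ 1 * monomial τ 1 := by
      rw [monomial_mul, one_mul]
    rw [hmul, Derivation.leibniz, hσ, hτ, map_add, smul_eq_mul, smul_eq_mul, mul_smul_comm,
      mul_smul_comm, mul_comm (monomial τ 1)]
    push_cast
    module
  | single k e =>
    have hX : shift R 0 (X k) = ((k : R) + 1) • X k := by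
      rw [shift_X, show (0 : ℤ) - k - 1 = -(k + 1) by ring, osc_neg_one]
    rw [← X_pow_eq_monomial, Derivation.leibniz_pow, hX, wt_single]
    rcases e with _ | e
    · simp
    · rw [Nat.add_sub_cancel, smul_eq_mul, mul_smul_comm, ← pow_succ, ← Nat.cast_smul_eq_nsmul R,
        smul_smul]
      push_cast
      rfl

theorem coeff_shift_zero (τ : ℕ →₀ ℕ) (f : Space R) :
    coeff τ (shift R 0 f) = wt τ * coeff τ f := by
  induction f using MvPolynomial.induction_on' with
  | monomial σ a =>
    rw [← mul_one a, ← smul_eq_mul, ← smul_monomial, Derivation.map_smul, shift_zero_monomial,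
      coeff_smul, coeff_smul, coeff_smul, coeff_monomial]
    split_ifs with h
    · rw [h, smul_eq_mul, smul_eq_mul, smul_eq_mul]
      ring
    · simp
  | add p q hp hq => rw [map_add, coeff_add, coeff_add, hp, hq, mul_add]

/-- Schur's lemma for the Fock space: commuting with the creation operators, `Z` is determined by
`Z 1`, which is constant since `Z` commutes with the annihilation operators. -/
theorem eq_constantCoeff_smul_one_of_lie_osc [NoZeroDivisors R] [CharZero R]
    {Z : Module.End R (Space R)} (h : ∀ n, ⁅Z, osc R n⁆ = 0) : Z = constantCoeff (Z 1) • 1 := by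
  have hX (k : ℕ) (f : Space R) : Z (X k * f) = X k * Z f := by
    have hlie := LinearMap.congr_fun (h (-(k + 1))) f
    rw [osc_neg, Ring.lie_def] at hlie
    exact sub_eq_zero.mp hlie
  have hpderiv (k : ℕ) : pderiv k (Z 1) = 0 := by
    have hlie := LinearMap.congr_fun (h (k + 1)) 1
    rw [osc_pos, lie_smul (M := Module.End R (Space R)), Ring.lie_def,
      LinearMap.smul_apply, LinearMap.zero_apply] at hlie
    simpa using (smul_eq_zero.mp hlie).resolve_left (Nat.cast_add_one_ne_zero _)
  have hone : Z 1 = C (constantCoeff (Z 1)) := eq_C_of_pderiv_eq_zero hpderiv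
  refine LinearMap.ext fun f => ?_
  induction f using MvPolynomial.induction_on with
  | C a =>
    rw [← mul_one (C a), ← smul_eq_C_mul, map_smul, map_smul, hone]
    simp [smul_eq_C_mul]
  | add p q hp hq => rw [map_add, map_add, hp, hq]
  | mul_X p k hp =>
    rw [mul_comm, hX, hp]
    simp

end CommRing

section Field

variable (K : Type*) [Field K]

/-- The part `½ ∑ a_i a_{m-i}` of the `m`-th Virasoro operator in which `i` and `m - i` are
nonzero and have the same sign. -/
def quad (m : ℤ) : Module.End K (Space K) :=
  (1 / 2 : K) • ∑ i ∈ Finset.Ioo (min 0 m) (max 0 m), osc K i * osc K (m - i)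

/-- The `m`-th Virasoro operator `½ ∑ᵢ :a_i a_{m-i}:` on the Fock space. -/
def vir (m : ℤ) : Module.End K (Space K) := (shift K m).toLinearMap + quad K m

variable {K}

theorem vir_zero : vir K 0 = (shift K 0).toLinearMap := by
  simp [vir, quad]

theorem coeff_vir_zero (τ : ℕ →₀ ℕ) (f : Space K) :
    coeff τ (vir K 0 f) = wt τ * coeff τ f := by
  rw [vir_zero, Derivation.coeFn_coe, coeff_shift_zero]

theorem constantCoeff_vir_zero (f : Space K) : constantCoeff (vir K 0 f) = 0 := by
  rw [constantCoeff_eq, coeff_vir_zero, map_zero, Nat.cast_zero, zero_mul]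

theorem vir_one (m : ℤ) : vir K m 1 = quad K m 1 := by
  simp [vir]

theorem vir_one_of_neg_one_le {m : ℤ} (hm : -1 ≤ m) : vir K m 1 = 0 := by
  rw [vir_one, quad, LinearMap.smul_apply, LinearMap.sum_apply, Finset.sum_eq_zero, smul_zero]
  intro i hi
  rw [Finset.mem_Ioo] at hi
  rw [Module.End.mul_apply, osc_one_of_nonneg (by lia), map_zero]

theorem constantCoeff_vir_one (m : ℤ) : constantCoeff (vir K m 1) = 0 := by
  rcases le_or_gt 0 m with hm | hm
  · rw [vir_one_of_neg_one_le (by lia), map_zero]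
  · rw [vir_one, quad, LinearMap.smul_apply, LinearMap.sum_apply, constantCoeff_smul, map_sum,
      Finset.sum_eq_zero, smul_zero]
    intro i hi
    exact constantCoeff_osc (by grind) _

theorem quad_two : quad K 2 = (1 / 2 : K) • (osc K 1 * osc K 1) := by
  rw [quad, show Finset.Ioo (min 0 2) (max 0 2) = {(1 : ℤ)} by decide, Finset.sum_singleton]
  rfl

theorem vir_neg_two_one : vir K (-2) 1 = (1 / 2 : K) • (X 0 * X 0) := by
  rw [vir_one, quad, show Finset.Ioo (min 0 (-2)) (max 0 (-2)) = {(-1 : ℤ)} by decide,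
    Finset.sum_singleton, LinearMap.smul_apply]
  congr 1
  exact congrArg ((X 0 : Space K) * ·) (mul_one _)

variable [CharZero K]

theorem constantCoeff_vir_two_vir_neg_two_one :
    constantCoeff (vir K 2 (vir K (-2) 1)) = 1 / 2 := by
  have hosc : osc K 1 = (pderiv 0 : Derivation K (Space K) (Space K)).toLinearMap := by
    simpa using osc_pos K 0
  rw [vir_neg_two_one, map_smul, vir, quad_two, hosc]
  simp only [LinearMap.add_apply, LinearMap.smul_apply, Module.End.mul_apply,
    Derivation.coeFn_coe, Derivation.leibniz, pderiv_X_self, smul_eq_mul, mul_one, map_add,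
    constantCoeff_smul, map_mul, constantCoeff_X, zero_mul, zero_add, map_one]
  norm_num

theorem quad_lie_osc (m n : ℤ) : ⁅quad K m, osc K n⁆ =
    if -n ∈ Finset.Ioo (min 0 m) (max 0 m) then (-n : K) • osc K (m + n) else 0 := by
  have hsymm : m + n ∈ Finset.Ioo (min 0 m) (max 0 m) ↔ -n ∈ Finset.Ioo (min 0 m) (max 0 m) := by
    rw [Finset.mem_Ioo, Finset.mem_Ioo]
    lia
  rw [quad, smul_lie (L := Module.End K (Space K)), LieRing.of_associative_ring_bracket,
    Finset.sum_mul, Finset.mul_sum, ← Finset.sum_sub_distrib]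
  simp only [← LieRing.of_associative_ring_bracket, osc_mul_osc_lie_osc]
  rw [Finset.sum_add_distrib, Finset.sum_ite_eq, Finset.sum_ite_eq]
  simp only [hsymm]
  split_ifs
  · module
  · rw [add_zero, smul_zero]

theorem vir_lie_osc (m n : ℤ) : ⁅vir K m, osc K n⁆ = (-n : K) • osc K (m + n) := by
  rw [vir, add_lie, shift_lie_osc, quad_lie_osc]
  split_ifs <;> simp

theorem wittDefect_vir_lie_osc (m n k : ℤ) : ⁅wittDefect K (vir K) m n, osc K k⁆ = 0 := by
  rw [wittDefect, sub_lie, lie_lie, vir_lie_osc, vir_lie_osc,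
    lie_smul (M := Module.End K (Space K)), lie_smul (M := Module.End K (Space K)),
    smul_lie (L := Module.End K (Space K)), vir_lie_osc, vir_lie_osc, vir_lie_osc,
    show n + (m + k) = m + n + k by ring, show m + (n + k) = m + n + k by ring]
  push_cast
  module

theorem wittDefect_vir (m n : ℤ) : wittDefect K (vir K) m n =
    (constantCoeff (vir K m (vir K n 1)) - constantCoeff (vir K n (vir K m 1))) • 1 := by
  rw [eq_constantCoeff_smul_one_of_lie_osc (wittDefect_vir_lie_osc m n), wittDefect, Ring.lie_def]
  simp only [LinearMap.sub_apply, Module.End.mul_apply, LinearMap.smul_apply, map_sub,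
    constantCoeff_smul, constantCoeff_vir_one, smul_zero, sub_zero]

theorem isNormalizedProjectiveWittFamily_vir : IsNormalizedProjectiveWittFamily K (vir K) where
  wittDefect_lie m n Z := by
    rw [wittDefect_vir, smul_lie (L := Module.End K (Space K)), Ring.lie_def, one_mul, mul_one,
      sub_self, smul_zero]
  lie_zero m := by
    rw [lie_eq_add_wittDefect (K := K), wittDefect_vir, constantCoeff_vir_zero,
      vir_one_of_neg_one_le (m := 0) (by lia)]
    simp
  lie_one_neg_one := by
    rw [lie_eq_add_wittDefect (K := K), wittDefect_vir, vir_one_of_neg_one_le (m := 1) (by lia),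
      vir_one_of_neg_one_le le_rfl, map_zero (vir K 1), map_zero (vir K (-1)), add_neg_cancel]
    push_cast
    module

theorem isVirasoroFamily_vir : IsVirasoroFamily K (vir K) 1 := by
  have hcharge : (2 : K) • wittDefect K (vir K) 2 (-2) = 1 := by
    rw [wittDefect_vir, constantCoeff_vir_two_vir_neg_two_one,
      vir_one_of_neg_one_le (m := 2) (by lia), map_zero, map_zero]
    module
  exact hcharge ▸ isNormalizedProjectiveWittFamily_vir.isVirasoroFamily

theorem wt_eq_of_coeff_vir_ne_zero {m : ℤ} {σ τ : ℕ →₀ ℕ}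
    (h : coeff τ (vir K m (monomial σ 1)) ≠ 0) : (wt τ : ℤ) + m = wt σ := by
  have hlie := congrArg (coeff τ)
    (LinearMap.congr_fun (isNormalizedProjectiveWittFamily_vir (K := K) |>.lie_zero m)
      (monomial σ 1))
  rw [Ring.lie_def, LinearMap.sub_apply, Module.End.mul_apply, Module.End.mul_apply, coeff_sub,
    coeff_vir_zero, vir_zero, Derivation.coeFn_coe, shift_zero_monomial, map_smul, coeff_smul,
    LinearMap.smul_apply, coeff_smul, smul_eq_mul, smul_eq_mul, ← sub_mul] at hlie
  have hwt : ((wt τ : ℤ) + m : K) = (wt σ : ℤ) := by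
    have := mul_right_cancel₀ h hlie
    push_cast at this ⊢
    linear_combination -this
  exact_mod_cast hwt

end Field

end Fock

/-! ### Compressions of operators of bounded propagation -/

section Subexponential

/-- A sequence of subexponential growth: `s N * x ^ N` is bounded for every `0 < x < 1`. -/
def IsSubexponential (s : ℕ → ℝ) : Prop :=
  ∀ x ∈ Set.Ioo (0 : ℝ) 1, BddAbove (Set.range fun N => s N * x ^ N)

theorem exists_mem_Ioo_one_lt_mul_pow {r : ℝ} (hr : 1 < r) (k : ℕ) :
    ∃ x ∈ Set.Ioo (0 : ℝ) 1, 1 < r * x ^ k := by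
  have hlim : Tendsto (fun x : ℝ => r * x ^ k) (𝓝[<] 1) (𝓝 r) := by
    have hcont : Continuous fun x : ℝ => r * x ^ k := by fun_prop
    simpa using hcont.continuousWithinAt.tendsto (x := 1) (s := Set.Iio 1)
  exact (Filter.Eventually.and (Ioo_mem_nhdsLT one_pos) (hlim.eventually_const_lt hr)).exists

theorem IsSubexponential.exists_add_lt_mul {s : ℕ → ℝ} (hs : IsSubexponential s) {N₀ : ℕ}
    (hN₀ : 0 < s N₀) {r : ℝ} (hr : 1 < r) (k : ℕ) : ∃ N, s (N + k) < r * s N := by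
  by_contra! hle
  have hpow (j : ℕ) : r ^ j * s N₀ ≤ s (N₀ + j * k) := by
    induction j with
    | zero => simp
    | succ j ih =>
      calc r ^ (j + 1) * s N₀ = r * (r ^ j * s N₀) := by ring
        _ ≤ r * s (N₀ + j * k) := by gcongr
        _ ≤ s (N₀ + j * k + k) := hle _
        _ = s (N₀ + (j + 1) * k) := by congr 1; ring
  obtain ⟨x, hx, hrx⟩ := exists_mem_Ioo_one_lt_mul_pow hr k
  obtain ⟨C, hC⟩ := hs x hx
  have hx₀ : 0 < x := hx.1
  obtain ⟨j, hj⟩ := pow_unbounded_of_one_lt (C / (s N₀ * x ^ N₀)) hrx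
  rw [div_lt_iff₀ (by positivity)] at hj
  refine (hj.trans_le ?_).not_ge (hC ⟨N₀ + j * k, rfl⟩)
  calc (r * x ^ k) ^ j * (s N₀ * x ^ N₀) = r ^ j * s N₀ * x ^ (N₀ + j * k) := by
        rw [mul_pow, ← pow_mul, pow_add, mul_comm k j]
        ring
    _ ≤ s (N₀ + j * k) * x ^ (N₀ + j * k) := by gcongr; exact hpow j

theorem tendsto_card_atTop_of_mem_iff {ι : Type*} [Infinite ι] {w : ι → ℕ}
    {ball : ℕ → Finset ι} (mem_ball : ∀ {N i}, i ∈ ball N ↔ w i ≤ N) :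
    Tendsto (fun N => (ball N).card) atTop atTop := by
  refine tendsto_atTop_atTop_of_monotone (fun M N hMN => Finset.card_le_card fun i hi =>
    mem_ball.mpr ((mem_ball.mp hi).trans hMN)) fun m => ?_
  obtain ⟨T, hT⟩ := Infinite.exists_subset_card_eq ι m
  exact ⟨T.sup w, hT ▸ Finset.card_le_card fun i hi => mem_ball.mpr (Finset.le_sup hi)⟩

end Subexponential

namespace Sofic

section Compression

variable {R V ι : Type*} [CommRing R] [AddCommGroup V] [Module R V]

/-- The compression of an operator to the span of finitely many vectors of a basis `b`, as a
matrix; the finite set `S` of indices is enumerated by `S.equivFin`. -/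
def compress (b : Module.Basis ι R V) (S : Finset ι) :
    Module.End R V →ₗ[R] Matrix (Fin S.card) (Fin S.card) R where
  toFun A := Matrix.of fun i j => b.repr (A (b (S.equivFin.symm j))) (S.equivFin.symm i)
  map_add' A B := by
    ext i j
    simp
  map_smul' a A := by
    ext i j
    simp

variable (b : Module.Basis ι R V)

theorem compress_apply (S : Finset ι) (A : Module.End R V) (i j : Fin S.card) :
    compress b S A i j = b.repr (A (b (S.equivFin.symm j))) (S.equivFin.symm i) := rfl

theorem compress_one (S : Finset ι) : compress b S 1 = 1 := by
  classical
  ext i j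
  rw [compress_apply, Module.End.one_apply, b.repr_self, Finsupp.single_apply, Matrix.one_apply]
  exact if_congr (by rw [Subtype.val_inj, EmbeddingLike.apply_eq_iff_eq, eq_comm]) rfl rfl

theorem repr_mul_apply (A B : Module.End R V) (i j : ι) :
    b.repr ((A * B) (b j)) i = (b.repr (B (b j))).sum fun k a => a * b.repr (A (b k)) i := by
  conv_lhs => rw [Module.End.mul_apply, ← b.linearCombination_repr (B (b j))]
  rw [Finsupp.linearCombination_apply, map_finsuppSum, map_finsuppSum, Finsupp.sum_apply]
  simp only [map_smul, Finsupp.smul_apply, smul_eq_mul]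

theorem compress_mul_compress_apply (A B : Module.End R V) {S : Finset ι} {j : Fin S.card}
    (hB : (b.repr (B (b (S.equivFin.symm j)))).support ⊆ S) (i : Fin S.card) :
    (compress b S A * compress b S B) i j = compress b S (A * B) i j := by
  rw [compress_apply, repr_mul_apply, Finsupp.sum_of_support_subset _ hB _ (by simp),
    Matrix.mul_apply, ← Finset.sum_coe_sort S, ← S.equivFin.symm.sum_comp]
  exact Finset.sum_congr rfl fun k _ => mul_comm _ _

/-- The operators of bounded propagation with respect to a basis `b` whose vectors have weights
`w`: those that raise the weight of every basis vector by at most a constant. -/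
def boundedPropagation (w : ι → ℕ) : Subalgebra R (Module.End R V) where
  carrier := {A | ∃ d, ∀ j i, b.repr (A (b j)) i ≠ 0 → w i ≤ w j + d}
  mul_mem' := by
    rintro A B ⟨d, hA⟩ ⟨e, hB⟩
    refine ⟨e + d, fun j i hij => ?_⟩
    rw [repr_mul_apply] at hij
    obtain ⟨k, -, hk⟩ := Finset.exists_ne_zero_of_sum_ne_zero hij
    have hki := hA k i (right_ne_zero_of_mul hk)
    have hjk := hB j k (left_ne_zero_of_mul hk)
    lia
  add_mem' := by
    rintro A B ⟨d, hA⟩ ⟨e, hB⟩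
    refine ⟨d + e, fun j i hij => ?_⟩
    rw [LinearMap.add_apply, map_add, Finsupp.add_apply] at hij
    by_cases hAij : b.repr (A (b j)) i = 0
    · rw [hAij, zero_add] at hij
      exact (hB j i hij).trans (by lia)
    · exact (hA j i hAij).trans (by lia)
  algebraMap_mem' a := by
    classical
    refine ⟨0, fun j i hij => ?_⟩
    rw [Module.algebraMap_end_apply, map_smul, b.repr_self, Finsupp.smul_apply,
      Finsupp.single_apply] at hij
    have hji : j = i := by
      by_contra hne
      simp [hne] at hij
    rw [hji, add_zero]

end Compression

section Ultraproduct

variable {F V ι : Type*} [Field F] [AddCommGroup V] [Module F V] (b : Module.Basis ι F V)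

theorem rank_le_card_of_col_eq_zero {m n : Type*} [Finite m] [Fintype n] (A : Matrix m n F)
    (s : Finset n) (h : ∀ j ∉ s, ∀ i, A i j = 0) : A.rank ≤ s.card := by
  have := Fintype.ofFinite m
  rw [← Matrix.rank_transpose]
  refine Matrix.rank_le_card_of_support_subset _ s ?_
  rw [Function.support_subset_iff']
  exact fun j hj => funext (h j hj)

theorem rank_compress_mul_compress_sub_add_card_le {S G : Finset ι} (hGS : G ⊆ S)
    (A B : Module.End F V) (hB : ∀ j ∈ G, (b.repr (B (b j))).support ⊆ S) :
    (compress b S A * compress b S B - compress b S (A * B)).rank + G.card ≤ S.card := by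
  classical
  let bad : Finset (Fin S.card) := Finset.univ.filter fun j => (S.equivFin.symm j : ι) ∉ G
  have hrank := rank_le_card_of_col_eq_zero
    (compress b S A * compress b S B - compress b S (A * B)) bad fun j hj i => by
      have hjG : (S.equivFin.symm j : ι) ∈ G := by simpa [bad] using hj
      rw [Matrix.sub_apply, compress_mul_compress_apply b A B (hB _ hjG), sub_self]
  have hbad : bad.card ≤ (S \ G).card := by
    refine Finset.card_le_card_of_injOn (fun j => (S.equivFin.symm j : ι)) (fun j hj => ?_)
      fun i _ j _ hij => S.equivFin.symm.injective (Subtype.ext hij)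
    exact Finset.mem_sdiff.mpr ⟨(S.equivFin.symm j).2, (Finset.mem_filter.mp hj).2⟩
  have hsdiff := Finset.card_sdiff_add_card_eq_card hGS
  lia

theorem normalizedRank_compress_mul_compress_sub_le {S G : Finset ι} (hGS : G ⊆ S) {ε : ℝ}
    (hε : 0 ≤ ε) (hS : (S.card : ℝ) ≤ (1 + ε) * G.card) (A B : Module.End F V)
    (hB : ∀ j ∈ G, (b.repr (B (b j))).support ⊆ S) :
    normalizedRank (compress b S A * compress b S B - compress b S (A * B)) ≤ ε := by
  have hrank : ((compress b S A * compress b S B - compress b S (A * B)).rank : ℝ) + G.card ≤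
      S.card := mod_cast rank_compress_mul_compress_sub_add_card_le b hGS A B hB
  have hcard : (G.card : ℝ) ≤ S.card := mod_cast Finset.card_le_card hGS
  refine div_le_of_le_mul₀ (Nat.cast_nonneg _) hε ?_
  nlinarith [mul_le_mul_of_nonneg_left hcard hε]

theorem one_ne_zero_ultraproduct {ω : Ultrafilter ℕ} {n : ℕ → ℕ} (hω : (ω : Filter ℕ) ≤ atTop)
    (hn : Tendsto n atTop atTop) : (1 : Ultraproduct F ω n) ≠ 0 := by
  intro h
  have hzero : Tendsto (fun k => normalizedRank (1 : Matrix (Fin (n k)) (Fin (n k)) F))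
      (ω : Filter ℕ) (𝓝 0) := Ideal.Quotient.eq_zero_iff_mem.mp h
  have hone : ∀ᶠ k in (ω : Filter ℕ),
      normalizedRank (1 : Matrix (Fin (n k)) (Fin (n k)) F) = 1 := by
    filter_upwards [hω (hn.eventually_gt_atTop 0)] with k hk
    rw [normalizedRank, Matrix.rank_one, Fintype.card_fin, div_self (by exact_mod_cast hk.ne')]
  exact one_ne_zero (tendsto_nhds_unique (tendsto_const_nhds.congr' (hone.mono fun _ => Eq.symm))
    hzero)

/-- The homomorphism `A ↦ (compress A to S_k)_k` into the metric ultraproduct, defined on a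
subalgebra on which the compressions to the finite sets `S_k` are asymptotically
multiplicative. -/
def compressHom (ω : Ultrafilter ℕ) (S : ℕ → Finset ι) (𝒜 : Subalgebra F (Module.End F V))
    (h : ∀ A ∈ 𝒜, ∀ B ∈ 𝒜, Tendsto (fun k => normalizedRank
      (compress b (S k) A * compress b (S k) B - compress b (S k) (A * B))) ω (𝓝 0)) :
    𝒜 →ₐ[F] Ultraproduct F ω fun k => (S k).card :=
  let q := Ideal.Quotient.mkₐ F (rankKernel F ω fun k => (S k).card)
  AlgHom.ofLinearMap
    (q.toLinearMap ∘ₗ LinearMap.pi (fun k => compress b (S k)) ∘ₗ 𝒜.val.toLinearMap)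
    ((congrArg q (funext fun k => compress_one b (S k))).trans (map_one q))
    fun A B => (Ideal.Quotient.eq.mpr (h A A.2 B B.2)).symm.trans (map_mul q _ _)

theorem exists_algHom_ultraproduct_of_isSubexponential [Infinite ι] {w : ι → ℕ}
    {ball : ℕ → Finset ι} (mem_ball : ∀ {N i}, i ∈ ball N ↔ w i ≤ N)
    (hball : IsSubexponential fun N => (ball N).card) :
    ∃ (ω : Ultrafilter ℕ) (n : ℕ → ℕ), (ω : Filter ℕ) ≤ cofinite ∧ Tendsto n atTop atTop ∧
      Nonempty (boundedPropagation b w →ₐ[F] Ultraproduct F ω n) := by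
  have hmono {M N : ℕ} (hMN : M ≤ N) : ball M ⊆ ball N := fun i hi =>
    mem_ball.mpr ((mem_ball.mp hi).trans hMN)
  have hcard := tendsto_card_atTop_of_mem_iff mem_ball
  obtain ⟨N₀, hN₀⟩ := (hcard.eventually_gt_atTop 0).exists
  choose N hN using fun k : ℕ => hball.exists_add_lt_mul (N₀ := N₀) (mod_cast hN₀)
    (lt_add_of_pos_right 1 (Nat.one_div_pos_of_nat (n := k) (α := ℝ))) k
  refine ⟨hyperfilter ℕ, fun k => (ball (N k + k)).card, hyperfilter_le_cofinite,
    hcard.comp (tendsto_atTop_mono (fun k => Nat.le_add_left k (N k)) tendsto_id),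
    ⟨compressHom b _ (fun k => ball (N k + k)) _ fun A _ B hB => ?_⟩⟩
  obtain ⟨d, hd⟩ := hB
  refine squeeze_zero' (.of_forall fun _ => normalizedRank_nonneg _) ?_
    (tendsto_one_div_add_atTop_nhds_zero_nat.mono_left Nat.hyperfilter_le_atTop)
  filter_upwards [Nat.hyperfilter_le_atTop (eventually_ge_atTop d)] with k hk
  refine normalizedRank_compress_mul_compress_sub_le b (hmono (Nat.le_add_right _ _))
    (by positivity) (hN k).le A B fun j hj i hi => mem_ball.mpr ?_
  have hij := hd j i (Finsupp.mem_support_iff.mp hi)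
  have hjN := mem_ball.mp hj
  lia

end Ultraproduct

end Sofic

/-! ### Growth of the Fock space and soficity -/

namespace Fock

/-- The finite set of the exponents of all monomials of weight at most `N`; such a monomial
involves only `X_k` with `k < N`, to powers at most `N`. -/
def ball (N : ℕ) : Finset (ℕ →₀ ℕ) :=
  ((Finset.range N).finsupp fun _ => Finset.range (N + 1)).filter fun σ => wt σ ≤ N

theorem mem_ball {N : ℕ} {σ : ℕ →₀ ℕ} : σ ∈ ball N ↔ wt σ ≤ N := by
  rw [ball, Finset.mem_filter, and_iff_right_iff_imp]
  intro h
  rw [Finset.mem_finsupp_iff]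
  refine ⟨fun k hk => Finset.mem_range.mpr ?_, fun k _ => Finset.mem_range_succ_iff.mpr ?_⟩
  · exact (Finsupp.le_weight_of_ne_zero' (fun k : ℕ => k + 1)
      (Finsupp.mem_support_iff.mp hk)).trans h
  · exact (Finsupp.le_weight (fun k : ℕ => k + 1) (Nat.succ_ne_zero k) σ).trans h

theorem wt_indicator (s : Finset ℕ) (p : ∀ k ∈ s, ℕ) :
    wt (Finsupp.indicator s p) = ∑ k ∈ s, Finsupp.indicator s p k * (k + 1) := by
  rw [wt, Finsupp.weight_apply,
    Finsupp.sum_of_support_subset _ (Finsupp.support_indicator_subset _ _) _ (by simp)]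
  rfl

theorem sum_pow_wt {R : Type*} [CommSemiring R] (x : R) (s t : Finset ℕ) :
    ∑ σ ∈ s.finsupp fun _ => t, x ^ wt σ = ∏ k ∈ s, ∑ e ∈ t, (x ^ (k + 1)) ^ e := by
  rw [Finset.prod_sum, Finset.finsupp, Finset.sum_map]
  refine Finset.sum_congr (by congr!) fun p _ => ?_
  rw [Function.Embedding.coeFn_mk, wt_indicator, ← Finset.prod_pow_eq_pow_sum,
    ← Finset.prod_attach]
  refine Finset.prod_congr rfl fun k _ => ?_
  rw [Finsupp.indicator_of_mem k.2, ← pow_mul, mul_comm]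

end Fock

theorem geom_sum_le_exp {x y : ℝ} (hy : 0 ≤ y) (hyx : y ≤ x) (hx : x < 1) (N : ℕ) :
    ∑ e ∈ Finset.range N, y ^ e ≤ Real.exp (y / (1 - x)) := by
  have hy₁ : y < 1 := hyx.trans_lt hx
  have : 0 < 1 - x := sub_pos.mpr hx
  have : 0 < 1 - y := sub_pos.mpr hy₁
  calc ∑ e ∈ Finset.range N, y ^ e ≤ (1 - y)⁻¹ := by
        rw [← tsum_geometric_of_lt_one hy hy₁]
        exact (summable_geometric_of_lt_one hy hy₁).sum_le_tsum _ fun _ _ => by positivity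
    _ = y / (1 - y) + 1 := by field_simp; ring
    _ ≤ y / (1 - x) + 1 := by gcongr
    _ ≤ Real.exp (y / (1 - x)) := Real.add_one_le_exp _

namespace Fock

theorem card_ball_mul_pow_le {x : ℝ} (hx : x ∈ Set.Ioo (0 : ℝ) 1) (N : ℕ) :
    (ball N).card * x ^ N ≤ Real.exp ((1 - x)⁻¹ / (1 - x)) := by
  obtain ⟨hx₀, hx₁⟩ := hx
  have : 0 < 1 - x := sub_pos.mpr hx₁
  calc ((ball N).card : ℝ) * x ^ N = ∑ _ ∈ ball N, x ^ N := by
        rw [Finset.sum_const, nsmul_eq_mul]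
    _ ≤ ∑ σ ∈ ball N, x ^ wt σ :=
      Finset.sum_le_sum fun _ hσ => pow_le_pow_of_le_one hx₀.le hx₁.le (mem_ball.mp hσ)
    _ ≤ ∑ σ ∈ (Finset.range N).finsupp fun _ => Finset.range (N + 1), x ^ wt σ :=
      Finset.sum_le_sum_of_subset_of_nonneg (Finset.filter_subset _ _) fun _ _ _ => by positivity
    _ = ∏ k ∈ Finset.range N, ∑ e ∈ Finset.range (N + 1), (x ^ (k + 1)) ^ e := sum_pow_wt _ _ _
    _ ≤ ∏ k ∈ Finset.range N, Real.exp (x ^ (k + 1) / (1 - x)) := by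
      gcongr with k
      exact geom_sum_le_exp (by positivity) (pow_le_of_le_one hx₀.le hx₁.le k.succ_ne_zero) hx₁ _
    _ = Real.exp ((∑ k ∈ Finset.range N, x ^ (k + 1)) / (1 - x)) := by
      rw [← Real.exp_sum, Finset.sum_div]
    _ ≤ Real.exp ((∑ k ∈ Finset.range N, x ^ k) / (1 - x)) := by
      gcongr Real.exp ((∑ k ∈ _, ?_) / _) with k
      exact pow_le_pow_of_le_one hx₀.le hx₁.le k.le_succ
    _ ≤ Real.exp ((1 - x)⁻¹ / (1 - x)) := by
      gcongr
      rw [← tsum_geometric_of_lt_one hx₀.le hx₁]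
      exact (summable_geometric_of_lt_one hx₀.le hx₁).sum_le_tsum _ fun _ _ => by positivity

theorem isSubexponential_card_ball : IsSubexponential fun N => (ball N).card := fun _ hx =>
  ⟨_, Set.forall_mem_range.mpr (card_ball_mul_pow_le hx)⟩

theorem vir_mem_boundedPropagation {K : Type*} [Field K] [CharZero K] (m : ℤ) :
    vir K m ∈ Sofic.boundedPropagation (MvPolynomial.basisMonomials ℕ K) wt := by
  refine ⟨m.natAbs, fun σ τ h => ?_⟩
  rw [MvPolynomial.coe_basisMonomials] at h
  have hwt := wt_eq_of_coeff_vir_ne_zero h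
  lia

end Fock

namespace Virasoro

theorem exists_isVirasoroFamily_ultraproduct (K : Type*) [Field K] [CharZero K] :
    ∃ (ω : Ultrafilter ℕ) (n : ℕ → ℕ), (ω : Filter ℕ) ≤ cofinite ∧ Tendsto n atTop atTop ∧
      ∃ y : ℤ → Sofic.Ultraproduct K ω n, IsVirasoroFamily K y 1 := by
  obtain ⟨ω, n, hω, hn, ⟨φ⟩⟩ := Sofic.exists_algHom_ultraproduct_of_isSubexponential
    (MvPolynomial.basisMonomials ℕ K) Fock.mem_ball Fock.isSubexponential_card_ball
  let y (m : ℤ) : Sofic.boundedPropagation (MvPolynomial.basisMonomials ℕ K) Fock.wt :=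
    ⟨Fock.vir K m, Fock.vir_mem_boundedPropagation m⟩
  have hy : IsVirasoroFamily K y 1 := .of_map
    (φ := (Sofic.boundedPropagation (MvPolynomial.basisMonomials ℕ K) Fock.wt).val.toLieHom)
    Subtype.val_injective Fock.isVirasoroFamily_vir
  have hφ := hy.map φ.toLieHom
  rw [AlgHom.toLieHom_apply, map_one] at hφ
  exact ⟨ω, n, hω, hn, _, hφ⟩

theorem isSofic : Sofic.IsSofic ℂ VirasoroAlgebra := by
  obtain ⟨ω, n, hω, hn, y, hy⟩ := exists_isVirasoroFamily_ultraproduct ℂ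
  have hc : hy.lift c ≠ 0 := by
    rw [hy.lift_c]
    exact Sofic.one_ne_zero_ultraproduct (hω.trans Nat.cofinite_eq_atTop.le) hn
  refine ⟨ω, n, fun k hk => ?_, hn, hy.lift, injective_of_map_c_ne_zero hc⟩
  have hkω : {k}ᶜ ∈ (ω : Filter ℕ) := hω (Set.finite_singleton k).compl_mem_cofinite
  simp [hk] at hkω

end Virasoro

end

theorem mainTheorem7 :
    IsNontrivialCentralExtension Virasoro.proj ∧
      (∀ (L : Type*) [LieRing L] [LieAlgebra ℂ L] (p : L →ₗ⁅ℂ⁆ Witt),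
        IsNontrivialCentralExtension p →
          ∃ e : L ≃ₗ⁅ℂ⁆ VirasoroAlgebra, ∀ x, Virasoro.proj (e x) = p x) ∧
      Sofic.IsSofic ℂ VirasoroAlgebra :=
  ⟨Virasoro.isNontrivialCentralExtension_proj,
    fun _ _ _ _ hp => Virasoro.exists_equiv_of_isNontrivialCentralExtension hp,
    Virasoro.isSofic⟩
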